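/- Let $L/K$ be an abelian extension of number fields with Galois group $G$ that is at most tamely ramified (for every nonzero prime of $\mathfrak{O}_L$, its ramification index over $K$ is not divisible by its residue characteristic). Let $H$ be a commutative $K$-Hopf algebra with counit $\varepsilon$ and comultiplication $\Delta$, giving a Hopf–Galois structure on $L/K$: that is, $L$ is an $H$-module (compatibly with its $K$-vector space structure) such that $h\cdot 1=\varepsilon(h)1$ and $h\cdot(st)=\sum_{(h)}(h_{(1)}\cdot s)(h_{(2)}\cdot t)$ for all $h\in H$, $s,t\in L$ (where $\Delta(h)=\sum_{(h)}h_{(1)}\otimes h_{(2)}$), and the $K$-linear map $j:L\otimes_K H\to \mathrm{End}_K(L)$, $j(s\otimes h)(t)=s(h\cdot t)$, is bijective. Let $\mathfrak{B}$ be an ambiguous fractional ideal of $L$, i.e. $g(\mathfrak{B})=\mathfrak{B}$ for all $g\in G$. For a regular subgroup $N$ of the group $\mathrm{Perm}(G)$ of permutations of the set $G$ that is normalized by the group $\lambda(G)$ of left translations, let $G$ act on the group algebra $L[N]$ by acting on $L$ through Galois automorphisms and on $N$ by conjugation via $\lambda$, and let the fixed ring $L[N]^G$, with its $K$-Hopf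 algebra structure restricted from that of the $L$-Hopf algebra $L[N]$, act on $L$ by $$\Big(\sum_{\eta\in N}c_\eta\,\eta\Big)\cdot x=\sum_{\eta\in N}c_\eta\,\eta^{-1}(1_G)[x].$$ Say that $N$ is the underlying group of $H$ if there is an isomorphism of $K$-Hopf algebras $H\cong L[N]^G$ compatible with the actions on $L$. Then $H$ has an underlying group, and if $N$ is the underlying group of $H$, then $\mathfrak{B}$ is locally free over $\mathfrak{O}_L[N]^G=\mathfrak{O}_L[N]\cap L[N]^G$: for every nonzero prime $\mathfrak{p}$ of $\mathfrak{O}_K$, with $\mathfrak{O}_{K,\mathfrak{p}}$ the valuation ring of the completion of $K$ at $\mathfrak{p}$, the module $\mathfrak{B}_{\mathfrak{p}}=\mathfrak{O}_{K,\mathfrak{p}}\otimes_{\mathfrak{O}_K}\mathfrak{B}$ is free over $\mathfrak{O}_{K,\mathfrak{p}}\otimes_{\mathfrak{O}_K}\mathfrak{O}_L[N]^G$, a ring canonically identified with $\mathfrak{O}_{L,\mathfrak{p}}[N]^G$. -/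

import Mathlib

open scoped NumberField TensorProduct nonZeroDivisors

noncomputable section

namespace HopfGaloisModule

/-! ### Hopf-Galois structures -/

section HopfGalois

variable (K L H : Type*) [Field K] [Field L] [Algebra K L] [CommRing H] [HopfAlgebra K H]
  [Module H L] [IsScalarTower K H L]

/-- For `s t : L`, the `K`-linear map `H ⊗ H → L` sending `a ⊗ b` to `(a • s) * (b • t)`. -/
def actMul (s t : L) : H ⊗[K] H →ₗ[K] L :=
  LinearMap.mul' K L ∘ₗ TensorProduct.map
    ((LinearMap.toSpanSingleton H L s).restrictScalars K)
    ((LinearMap.toSpanSingleton H L t).restrictScalars K)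

/-- `L` is an `H`-module algebra. -/
structure IsModuleAlgebra : Prop where
  smul_one (h : H) : h • (1 : L) = algebraMap K L (Coalgebra.counit (R := K) h)
  smul_mul (h : H) (s t : L) : h • (s * t) = actMul K L H s t (Coalgebra.comul (R := K) h)

/-- The `K`-linear map `j : L ⊗ H → End_K(L)`, `j (s ⊗ h) t = s * (h • t)`. -/
def galoisMap : L ⊗[K] H →ₗ[K] Module.End K L :=
  LinearMap.mul' K (Module.End K L) ∘ₗ
    TensorProduct.map (Algebra.lmul K L).toLinearMap (Algebra.lsmul K K L (A := H)).toLinearMap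

theorem galoisMap_tmul (s t : L) (h : H) : galoisMap K L H (s ⊗ₜ h) t = s * (h • t) := rfl

theorem actMul_tmul (s t : L) (a b : H) : actMul K L H s t (a ⊗ₜ b) = (a • s) * (b • t) := rfl

/-- The given action of `H` on `L` is a Hopf-Galois structure on `L / K`. -/
structure IsHopfGalois : Prop extends IsModuleAlgebra K L H where
  bijective : Function.Bijective (galoisMap K L H)

end HopfGalois

/-! ### Greither-Pareigis Hopf algebras -/

section GreitherPareigis

variable (K L : Type*) [Field K] [Field L] [Algebra K L]

/-- A regular subgroup `N` of the group of permutations of the set `G = Gal(L/K)` that is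
normalized by the left translations `Equiv.mulLeft g`. -/
structure GPSubgroup where
  N : Subgroup (Equiv.Perm Gal(L/K))
  regular : ∀ g h : Gal(L/K), ∃! η : N, (η : Equiv.Perm Gal(L/K)) g = h
  normalized : ∀ (g : Gal(L/K)), ∀ η ∈ N, Equiv.mulLeft g * η * (Equiv.mulLeft g)⁻¹ ∈ N

variable {K L}

/-- The group algebra `L[N]`. -/
abbrev GPSubgroup.GroupAlgebra (P : GPSubgroup K L) : Type _ := MonoidAlgebra L P.N

/-- The action of `g` on `N`: conjugation by left translation by `g`. -/
def GPSubgroup.conj (P : GPSubgroup K L) (g : Gal(L/K)) : P.N →* P.N where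
  toFun η := ⟨Equiv.mulLeft g * η * (Equiv.mulLeft g)⁻¹, P.normalized g η η.2⟩
  map_one' := by ext; simp
  map_mul' η μ := by ext; simp

/-- The action of `g` on `L[N]`: on `L` as a Galois automorphism, on `N` through `conj`. -/
def GPSubgroup.galAct (P : GPSubgroup K L) (g : Gal(L/K)) :
    P.GroupAlgebra →ₐ[K] P.GroupAlgebra :=
  (MonoidAlgebra.mapAlgHom P.N (g : L →ₐ[K] L)).comp
    (MonoidAlgebra.mapDomainAlgHom K L (P.conj g))

theorem GPSubgroup.galAct_single (P : GPSubgroup K L) (g : Gal(L/K)) (η : P.N) (c : L) :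
    P.galAct g (MonoidAlgebra.single η c) = MonoidAlgebra.single (P.conj g η) (g c) := by
  simp [GPSubgroup.galAct]

/-- The fixed ring `L[N]^G`. -/
def GPSubgroup.fixedAlgebra (P : GPSubgroup K L) : Subalgebra K P.GroupAlgebra :=
  ⨅ g : Gal(L/K), AlgHom.equalizer (P.galAct g) (AlgHom.id K P.GroupAlgebra)

theorem GPSubgroup.mem_fixedAlgebra (P : GPSubgroup K L) (z : P.GroupAlgebra) :
    z ∈ P.fixedAlgebra ↔ ∀ g : Gal(L/K), P.galAct g z = z := by
  simp [GPSubgroup.fixedAlgebra, Algebra.mem_iInf]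

/-- The formula `(∑ c_η η) · x = ∑ c_η (η⁻¹(1))(x)`, for `c_η, x ∈ L`. -/
def GPSubgroup.act (P : GPSubgroup K L) : P.GroupAlgebra →ₗ[L] Module.End K L :=
  (Finsupp.linearCombination L fun η : P.N =>
      ((((η : Equiv.Perm Gal(L/K))⁻¹) 1 : Gal(L/K)) : L →ₐ[K] L).toLinearMap) ∘ₗ
    (MonoidAlgebra.coeffLinearEquiv L).toLinearMap

theorem GPSubgroup.act_single (P : GPSubgroup K L) (η : P.N) (c x : L) :
    P.act (MonoidAlgebra.single η c) x = c * ((η : Equiv.Perm Gal(L/K))⁻¹ 1) x := by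
  simp [GPSubgroup.act]

theorem GPSubgroup.galAct_single_mul_act (P : GPSubgroup K L) (g : Gal(L/K)) (ν : P.N)
    (hν : (ν : Equiv.Perm Gal(L/K))⁻¹ 1 = g) (w : P.GroupAlgebra) (c x : L) :
    P.act (MonoidAlgebra.single ν c * P.galAct g w) x = c * g (P.act w x) := by
  induction w using MonoidAlgebra.induction_linear with
  | zero => simp
  | add a b ha hb => simp only [map_add, mul_add, LinearMap.add_apply, ha, hb]
  | single μ d =>
    have h1 : (((ν * P.conj g μ : P.N) : Equiv.Perm Gal(L/K))⁻¹ 1) =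
        g * ((μ : Equiv.Perm Gal(L/K))⁻¹ 1) := by
      have h2 : g⁻¹ * ((ν : Equiv.Perm Gal(L/K))⁻¹ 1) = 1 := by rw [hν, inv_mul_cancel]
      simp only [Equiv.Perm.inv_def] at h2
      simp [GPSubgroup.conj, mul_assoc, h2]
    rw [P.galAct_single, MonoidAlgebra.single_mul_single, P.act_single, P.act_single, h1]
    simp [mul_assoc]

theorem GPSubgroup.act_mul (P : GPSubgroup K L) (z w : P.GroupAlgebra) (hw : w ∈ P.fixedAlgebra) :
    P.act (z * w) = P.act z * P.act w := by
  rw [P.mem_fixedAlgebra] at hw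
  ext x
  induction z using MonoidAlgebra.induction_linear with
  | zero => simp
  | add a b ha hb =>
    simp only [map_add, add_mul, LinearMap.add_apply, Module.End.mul_apply] at ha hb ⊢
    rw [ha, hb]
  | single ν c =>
    have h := P.galAct_single_mul_act _ ν rfl w c x
    rw [hw] at h
    rw [h, Module.End.mul_apply, P.act_single]

/-- `L` as a representation of `L[N]^G` through `act`. -/
def GPSubgroup.rep (P : GPSubgroup K L) : P.fixedAlgebra →ₐ[K] Module.End K L :=
  AlgHom.ofLinearMap ((P.act.restrictScalars K) ∘ₗ P.fixedAlgebra.val.toLinearMap)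
    (by ext x; simp [MonoidAlgebra.one_def, P.act_single])
    (fun z w => P.act_mul z w w.2)

theorem GPSubgroup.rep_apply (P : GPSubgroup K L) (z : P.fixedAlgebra) (x : L) :
    P.rep z x = P.act (z : P.GroupAlgebra) x := rfl

end GreitherPareigis

/-! ### The integral order and the modules over it -/

section Integral

set_option linter.unusedSectionVars false

variable {K L : Type*} [Field K] [NumberField K] [Field L] [NumberField L] [Algebra K L]

/-- The group ring `𝓞_L[N]`, inside `L[N]`. -/
def GPSubgroup.integralGroupRing (P : GPSubgroup K L) : Subalgebra (𝓞 K) P.GroupAlgebra :=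
  (MonoidAlgebra.mapAlgHom P.N (IsScalarTower.toAlgHom (𝓞 K) (𝓞 L) L)).range

theorem GPSubgroup.mem_integralGroupRing (P : GPSubgroup K L) (z : P.GroupAlgebra) :
    z ∈ P.integralGroupRing ↔
      ∃ w : MonoidAlgebra (𝓞 L) P.N, ∀ η, algebraMap (𝓞 L) L (w.coeff η) = z.coeff η := by
  simp only [GPSubgroup.integralGroupRing]
  refine exists_congr fun w => ⟨fun h η => by simp [← h], fun h => ?_⟩
  ext η
  simp [← h]

/-- The order `Λ^G = 𝓞_L[N]^G`, the elements of `𝓞_L[N]` that are fixed by `G`. -/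
def GPSubgroup.order (P : GPSubgroup K L) : Subalgebra (𝓞 K) P.GroupAlgebra :=
  P.integralGroupRing ⊓ P.fixedAlgebra.restrictScalars (𝓞 K)

theorem GPSubgroup.mem_order (P : GPSubgroup K L) (z : P.GroupAlgebra) :
    z ∈ P.order ↔ z ∈ P.integralGroupRing ∧ z ∈ P.fixedAlgebra := Iff.rfl

/-- `L` as a module over `𝓞_L[N]^G` through `act`. -/
instance GPSubgroup.orderModule (P : GPSubgroup K L) : Module P.order L :=
  Module.compHom L (P.rep.toRingHom.comp
    (Subring.inclusion (S := P.order.toSubring) (T := P.fixedAlgebra.toSubring) fun _ h => h.2))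

theorem GPSubgroup.order_smul (P : GPSubgroup K L) (z : P.order) (x : L) :
    z • x = P.act (z : P.GroupAlgebra) x := rfl

instance GPSubgroup.orderTower (P : GPSubgroup K L) : IsScalarTower (𝓞 K) P.order L where
  smul_assoc a z x := by
    rw [P.order_smul, P.order_smul]
    change P.act (a • (z : P.GroupAlgebra)) x = _
    have h : a • (z : P.GroupAlgebra) = (algebraMap (𝓞 K) L a) • (z : P.GroupAlgebra) := by
      ext η
      change a • (z : P.GroupAlgebra).coeff η = _
      simp [Algebra.smul_def]
    rw [h, map_smul, LinearMap.smul_apply, algebraMap_smul]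

variable (K) in
/-- The fractional ideal `B` of `L` is ambiguous: `g(B) = B` for all `g` in `Gal(L/K)`. -/
def IsAmbiguous (B : FractionalIdeal (𝓞 L)⁰ L) : Prop :=
  ∀ g : Gal(L/K), (g : L → L) '' (B : Set L) = B

/-- An ambiguous fractional ideal of `L`, as a module over `𝓞_L[N]^G`. -/
def GPSubgroup.idealModule (P : GPSubgroup K L) (B : FractionalIdeal (𝓞 L)⁰ L)
    (hB : IsAmbiguous K B) : Submodule P.order L where
  carrier := B
  add_mem' ha hb := (B : Submodule (𝓞 L) L).add_mem ha hb
  zero_mem' := (B : Submodule (𝓞 L) L).zero_mem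
  smul_mem' z x hx := by
    obtain ⟨w, hw⟩ := (P.mem_integralGroupRing _).1 z.2.1
    rw [P.order_smul]
    simp only [GPSubgroup.act, LinearMap.comp_apply, Finsupp.linearCombination_apply,
      Finsupp.sum, LinearMap.sum_apply]
    refine (B : Submodule (𝓞 L) L).sum_mem fun η _ => ?_
    have h1 : ((((η : Equiv.Perm Gal(L/K))⁻¹) 1 : Gal(L/K)) x) ∈ (B : Set L) := by
      rw [← hB ((((η : Equiv.Perm Gal(L/K))⁻¹) 1 : Gal(L/K)))]
      exact ⟨x, hx, rfl⟩
    have h2 := (B : Submodule (𝓞 L) L).smul_mem (w.coeff η) h1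
    rw [Algebra.smul_def, hw] at h2
    exact h2

variable (K L) in
/-- `L / K` is at most tamely ramified: the ramification index of every nonzero prime `Q` of `𝓞_L`
over `K` is not divisible by the residue characteristic of `Q`. -/
def IsTame : Prop :=
  ∀ Q : Ideal (𝓞 L), Q.IsPrime → Q ≠ ⊥ → ∀ p : ℕ, p.Prime → (p : 𝓞 L) ∈ Q →
    ¬ p ∣ Q.ramificationIdx (𝓞 K)

end Integral

/-! ### Local freeness -/

section LocallyFree

variable (R A Λ M : Type*) [CommRing R] [CommRing A] [Algebra R A] [Ring Λ] [Algebra R Λ]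
  [AddCommGroup M] [Module R M] [Module Λ M] [IsScalarTower R Λ M]

/-- The homomorphism `A ⊗ Λ → End_A(A ⊗ M)` given by the `Λ`-module structure of `M`. -/
def baseChangeRep : A ⊗[R] Λ →ₐ[A] Module.End A (A ⊗[R] M) :=
  Algebra.TensorProduct.lift (Algebra.ofId A (Module.End A (A ⊗[R] M)))
    ((Module.End.baseChangeHom R A M).comp (Algebra.lsmul R R M (A := Λ)))
    (fun a _ => by rw [Algebra.ofId_apply]; exact Algebra.commute_algebraMap_left a _)

theorem baseChangeRep_tmul (a b : A) (z : Λ) (m : M) :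
    baseChangeRep R A Λ M (a ⊗ₜ[R] z) (b ⊗ₜ[R] m) = (a * b) ⊗ₜ[R] (z • m) := by
  rw [baseChangeRep, Algebra.TensorProduct.lift_tmul, Algebra.ofId_apply, Module.End.mul_apply,
    Module.algebraMap_end_apply]
  rfl

/-- `A ⊗ M` as a module over `A ⊗ Λ`, with `(a ⊗ z) • (b ⊗ m) = (a * b) ⊗ (z • m)`. -/
abbrev baseChangeModule : Module (A ⊗[R] Λ) (A ⊗[R] M) :=
  Module.compHom (A ⊗[R] M) (baseChangeRep R A Λ M).toRingHom

variable (K : Type*) [Field K] [NumberField K] (Λ M : Type*) [Ring Λ] [Algebra (𝓞 K) Λ]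
  [AddCommGroup M] [Module (𝓞 K) M] [Module Λ M] [IsScalarTower (𝓞 K) Λ M]

/-- The `Λ`-module `M` is locally free: for every nonzero prime `v` of `𝓞_K`, the module
`M_v = 𝓞_{K,v} ⊗ M` is free over `Λ_v = 𝓞_{K,v} ⊗ Λ`, with `𝓞_{K,v}` the valuation ring of the
completion of `K` at `v`. -/
def IsLocallyFree : Prop :=
  ∀ v : IsDedekindDomain.HeightOneSpectrum (𝓞 K),
    letI := baseChangeModule (𝓞 K) (v.adicCompletionIntegers K) Λ M
    Module.Free (v.adicCompletionIntegers K ⊗[𝓞 K] Λ) (v.adicCompletionIntegers K ⊗[𝓞 K] M)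

end LocallyFree

/-! ### The underlying group of a Hopf-Galois structure -/

section Underlying

variable {K L : Type*} [Field K] [Field L] [Algebra K L]
  (H : Type*) [CommRing H] [HopfAlgebra K H] [Module H L]

/-- `P` is the underlying group of the Hopf-Galois structure given by `H`: there is an isomorphism
`φ` of `H` onto `L[N]^G` that respects the Hopf algebra structures (the ones on `L[N]^G` are
restricted from the `L`-Hopf algebra `L[N]`) and the actions on `L`. -/
def IsUnderlyingGroup (P : GPSubgroup K L) : Prop :=
  ∃ φ : H →ₐ[K] P.GroupAlgebra,
    Function.Injective φ ∧ φ.range = P.fixedAlgebra ∧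
    (∀ h, Coalgebra.counit (R := L) (φ h) = algebraMap K L (Coalgebra.counit (R := K) h)) ∧
    (∀ h, Coalgebra.comul (R := L) (φ h) =
      TensorProduct.mapOfCompatibleSMul L K K P.GroupAlgebra P.GroupAlgebra
        (TensorProduct.map φ.toLinearMap φ.toLinearMap (Coalgebra.comul (R := K) h))) ∧
    ∀ (h : H) (x : L), h • x = P.act (φ h) x

end Underlying

end HopfGaloisModule

end

/-! Existence of an underlying group. After base change to `L`, the map `j` identifies `L ⊗ H` with
`End_K(L)`, in which the automorphisms form an `L`-basis by Dedekind independence and a dimension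
count. The element `x_g` acting as `g` is group-like because `g` is multiplicative
(`isGroupLikeElem_galElem`); since group-likes are linearly independent, there are no others, so `L
⊗ H` is their group algebra. The identity `x_g * g(x_k) = x_{gk}` (`galElem_mul_galTensor`) turns
left multiplication on group-likes into a regular permutation group of `G` normalized by left
translations, and Galois descent recovers `H` as the fixed ring.

Local freeness. The fixed ring spans `L[N]` over `L`, so commutativity of `H` makes `N` abelian. At
a prime `v` it suffices to find `x` in `B` whose multiples under the order contain `s B` for some
`s` outside `v`: such an `x` has trivial annihilator when `B ≠ 0`, because the fixed ring is
commutative and acts faithfully. This is done over the localization `R` at `v`, a discrete valuation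
ring of residue characteristic `p`, with `S` the integral closure of `R` in `L`.

Split `N` into its `p`-part and its prime-to-`p` part. The orbits of `1` under the parts are
complementary subgroups `G₁` and `G₂` of `G`, and commutativity of `G` and `N` makes each orbit
centralize the opposite part (`conj_eq_self`). Tameness puts all inertia groups above `v` into `G₂`,
so the elements of `S` fixed by `G₂` have Galois coordinates `u_i, v_i` over `R`, and one of them,
`x₁`, has `G₁`-trace one.

On the `p`-part, the resolvent of `x₁` has augmentation one and is therefore a unit of the group
ring over `S` (`exists_mul_resolvent_eq_one`); hence each `u_i` is an integral multiple `w_i · x₁`.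
On the prime-to-`p` part, the group order is a unit of `R`, so integral elements of the fixed ring
have integral coefficients; these elements form the maximal order of a product of fields, over which
lattices are cyclic (`exists_generator_of_coprime`). This gives `x₂` with `Tr(v_i b) = z_i · x₂`.
Since `b = ∑ u_i Tr(v_i b)`, the element `∑ w_i z_i` carries `x₁ x₂` to `b`
(`exists_generator_of_isFactor`). -/

/-- Multiplication by `s` is bijective after base change to an algebra in which `s` is a unit. -/
theorem bijective_baseChange_smul_id {R A : Type*} [CommRing R] [CommRing A] [Algebra R A] (s : R)
    (hs : IsUnit (algebraMap R A s)) (X : Type*) [AddCommGroup X] [Module R X] :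
    Function.Bijective (LinearMap.baseChange A (s • (LinearMap.id : X →ₗ[R] X))) := by
  have : LinearMap.baseChange A (s • (LinearMap.id : X →ₗ[R] X)) =
      (algebraMap R A s) • LinearMap.id := by
    ext m
    simp [TensorProduct.smul_tmul', Algebra.smul_def, TensorProduct.tmul_smul]
  rw [this]
  exact (LinearEquiv.smulOfUnit hs.unit).bijective

/-! ### Freeness after base change from a generator up to a denominator. -/

section FreeOfGenerator

variable {R A Λ M : Type*} [CommRing R] [CommRing A] [Algebra R A] [Ring Λ] [Algebra R Λ]
  [AddCommGroup M] [Module R M] [Module Λ M] [IsScalarTower R Λ M]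

/-- If `Λ x` is free and contains `s M` for some `s : R` that becomes invertible in `A`, then
`A ⊗ M` is free over `A ⊗ Λ`. -/
theorem HopfGaloisModule.free_baseChange_of_generator (s : R) (hs : IsUnit (algebraMap R A s))
    (x : M) (hinj : ∀ z : Λ, z • x = 0 → z = 0) (hsurj : ∀ m : M, ∃ z : Λ, z • x = s • m) :
    letI := HopfGaloisModule.baseChangeModule R A Λ M
    Module.Free (A ⊗[R] Λ) (A ⊗[R] M) := by
  let := HopfGaloisModule.baseChangeModule R A Λ M
  let f : Λ →ₗ[R] M :=
    { toFun := fun z => z • x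
      map_add' := fun a b => add_smul a b x
      map_smul' := fun r a => by simp }
  have hf : Function.Injective f := (injective_iff_map_eq_zero f).2 hinj
  choose g hg using hsurj
  let g' : M →ₗ[R] Λ :=
    { toFun := g
      map_add' := fun a b => hf <| by
        rw [map_add]
        change g (a + b) • x = g a • x + g b • x
        rw [hg, hg, hg, smul_add]
      map_smul' := fun r a => hf <| by
        rw [map_smul]
        change g (r • a) • x = r • (g a • x)
        rw [hg, hg, smul_comm] }
  have hfg : f ∘ₗ g' = s • LinearMap.id := by
    ext m
    exact hg m
  have hgf : g' ∘ₗ f = s • LinearMap.id := by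
    ext z
    refine hf ?_
    change f (g (f z)) = f (s • z)
    rw [map_smul]
    exact hg _
  -- Both composites of `f` and `g'` are multiplication by `s`, which becomes invertible over `A`.
  have hbij : Function.Bijective (f.baseChange A) := by
    constructor
    · have h := (bijective_baseChange_smul_id (A := A) s hs Λ).1
      rw [← hgf, LinearMap.baseChange_comp] at h
      exact Function.Injective.of_comp (f := g'.baseChange A) h
    · have h := (bijective_baseChange_smul_id (A := A) s hs M).2
      rw [← hfg, LinearMap.baseChange_comp] at h
      exact Function.Surjective.of_comp (g := g'.baseChange A) h
  let F : (A ⊗[R] Λ) →ₗ[A ⊗[R] Λ] (A ⊗[R] M) := LinearMap.toSpanSingleton _ _ (1 ⊗ₜ[R] x)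
  have hF : ∀ w, F w = f.baseChange A w := by
    intro w
    induction w with
    | zero => simp
    | add a b ha hb => rw [map_add, map_add, ha, hb]
    | tmul a z =>
      change HopfGaloisModule.baseChangeRep R A Λ M (a ⊗ₜ[R] z) (1 ⊗ₜ[R] x) = _
      rw [HopfGaloisModule.baseChangeRep_tmul, mul_one]
      rfl
  have hF' : Function.Bijective F := by
    rw [show (F : A ⊗[R] Λ → A ⊗[R] M) = f.baseChange A from funext hF]
    exact hbij
  exact Module.Free.of_equiv (LinearEquiv.ofBijective F hF')

end FreeOfGenerator

/-! ### Inertia groups and residue rings of a fixed subring. -/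

section Inertia

open scoped Pointwise

variable {G S : Type*} [Group G] [Finite G] [CommRing S] [MulSemiringAction G S]
  (N : Subgroup G)

omit [Finite G] in
theorem smul_mem_of_fixed [N.Normal] {s : S} (hs : ∀ h ∈ N, h • s = s) (g : G) :
    ∀ h ∈ N, h • (g • s) = g • s := by
  intro h hh
  have := hs (g⁻¹ * h * g) (by simpa using ‹N.Normal›.conj_mem h hh g⁻¹)
  rw [mul_smul, mul_smul, inv_smul_eq_iff] at this
  exact this

/-- If `g ∉ N` and `N` contains all inertia groups, then `g` acts nontrivially on all residue rings
of `S^N`. -/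
theorem exists_smul_sub_notMem (hN : ∀ Q : Ideal S, Q.IsMaximal → Q.inertia G ≤ N)
    {g : G} (hg : g ∉ N) (m : Ideal (FixedPoints.subring S N)) [hm : m.IsMaximal] :
    ∃ s : FixedPoints.subring S N, ∀ t : FixedPoints.subring S N,
      (t : S) = g • (s : S) - s → t ∉ m := by
  by_contra! hcon
  have hint : Algebra.IsInvariant (FixedPoints.subring S N) S N :=
    ⟨fun b hb => ⟨⟨b, hb⟩, rfl⟩⟩
  have hI := Algebra.IsInvariant.isIntegral (FixedPoints.subring S N) S N
  have key : ∀ s : FixedPoints.subring S N,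
      ∃ t : FixedPoints.subring S N, (t : S) = g • (s : S) - s ∧ t ∈ m := by
    intro s
    obtain ⟨t, ht, ht'⟩ := hcon s
    exact ⟨t, ht, ht'⟩
  have hker : RingHom.ker (algebraMap (FixedPoints.subring S N) S) ≤ m := by
    intro x hx
    have : x = 0 := Subtype.ext hx
    rw [this]; exact m.zero_mem
  obtain ⟨Q, hQ, hQm⟩ := Ideal.exists_ideal_over_maximal_of_isIntegral
    (S := S) m hker
  have hmem : ∀ s : FixedPoints.subring S N, (s : S) ∈ Q ↔ s ∈ m := by
    intro s
    rw [← hQm, Ideal.mem_comap]; rfl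
  have hgQ : ∀ s : FixedPoints.subring S N, g • (s : S) - s ∈ Q := by
    intro s
    obtain ⟨t, ht, ht'⟩ := key s
    rw [← ht]
    exact (hmem t).2 ht'
  have hQp : Q.IsPrime := hQ.isPrime
  have hQp' : (g⁻¹ • Q).IsPrime := hQp.smul _
  -- As `g` is trivial on `S^N` modulo `m`, the primes `Q` and `g⁻¹ • Q` contract to the same prime
  -- of `S^N`, so they are conjugate under `N`.
  obtain ⟨⟨h, hhN⟩, hh⟩ := Algebra.IsInvariant.exists_smul_of_under_eq
    (FixedPoints.subring S N) S N Q (g⁻¹ • Q) (by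
      ext s
      rw [Ideal.under_def, Ideal.under_def, Ideal.mem_comap, Ideal.mem_comap,
        Ideal.mem_inv_pointwise_smul_iff]
      change (s : S) ∈ Q ↔ g • (s : S) ∈ Q
      have := hgQ s
      constructor
      · intro h
        simpa using Q.add_mem this h
      · intro h
        simpa using Q.sub_mem h this)
  have hk : (g * h) • Q = Q := by
    rw [mul_smul, show h • Q = g⁻¹ • Q from hh.symm, smul_inv_smul]
  have hQm' : Q.LiesOver m := ⟨hQm.symm⟩
  have hkm : ∀ x, x ∈ Q ↔ (g * h) • x ∈ Q := fun x => by
    conv_rhs => rw [← hk]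
    rw [Ideal.smul_mem_pointwise_smul_iff]
  let e : S ⧸ Q ≃+* S ⧸ Q := Ideal.quotientEquiv Q Q (MulSemiringAction.toRingEquiv G S (g * h)) (by
    conv_lhs => rw [← hk]
    rfl)
  have he : ∀ x : S, e (Ideal.Quotient.mk Q x) = Ideal.Quotient.mk Q ((g * h) • x) := fun x => rfl
  let E : (S ⧸ Q) ≃ₐ[FixedPoints.subring S N ⧸ m] (S ⧸ Q) := AlgEquiv.ofRingEquiv (f := e) (by
    intro r
    obtain ⟨r, rfl⟩ := Ideal.Quotient.mk_surjective r
    change e (Ideal.Quotient.mk Q (r : S)) = Ideal.Quotient.mk Q (r : S)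
    rw [he, Ideal.Quotient.eq, mul_smul, show h • (r : S) = r from r.2 ⟨h, hhN⟩]
    exact hgQ r)
  -- The automorphism of `S ⧸ Q` induced by `g * h` fixes `S^N ⧸ m`, so it is also induced by some
  -- `h'` in `N`. Then `h'⁻¹ * (g * h)` is inertial, hence in `N`, and so is `g`.
  obtain ⟨⟨⟨h', hh'N⟩, hstab⟩, hE⟩ := Ideal.Quotient.stabilizerHom_surjective N m Q E
  have h'Q : h' • Q = Q := hstab
  have hin : h'⁻¹ * (g * h) ∈ Q.inertia G := by
    intro x
    have h1 : Ideal.Quotient.mk Q (h' • x) = Ideal.Quotient.mk Q ((g * h) • x) := by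
      rw [← he]
      exact congrArg (fun F => F (Ideal.Quotient.mk Q x)) hE
    rw [eq_comm, Ideal.Quotient.eq] at h1
    change (h'⁻¹ * (g * h)) • x - x ∈ Q
    have h2 : (h'⁻¹ * (g * h)) • x - x = h'⁻¹ • ((g * h) • x - h' • x) := by
      rw [smul_sub, inv_smul_smul, ← mul_smul]
    rw [h2]
    have h3 : h'⁻¹ • Q = Q := by rw [inv_smul_eq_iff, h'Q]
    rw [← h3]
    exact Ideal.smul_mem_pointwise_smul _ _ _ h1
  have := hN Q hQ hin
  refine hg ?_
  have h4 := N.mul_mem (N.mul_mem hh'N this) (N.inv_mem hhN)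
  simpa [mul_assoc] using h4

end Inertia

/-! ### Galois coordinates for a fixed subring. -/

section GaloisCoordinates

variable {G S : Type*} [Group G] [Finite G] [CommRing S] [MulSemiringAction G S]
  (N : Subgroup G) [N.Normal]

/-- For `g : G`, the ring homomorphism `S^N ⊗ S^N → S` sending `u ⊗ v` to `u * g • v`. -/
noncomputable def twistedMul (g : G) :
    FixedPoints.subring S N ⊗[ℤ] FixedPoints.subring S N →ₐ[ℤ] S :=
  Algebra.TensorProduct.productMap (FixedPoints.subring S N).subtype.toIntAlgHom
    ((MulSemiringAction.toRingHom G S g).comp (FixedPoints.subring S N).subtype).toIntAlgHom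

omit [Finite G] [N.Normal] in
theorem twistedMul_tmul (g : G) (u v : FixedPoints.subring S N) :
    twistedMul N g (u ⊗ₜ v) = (u : S) * g • (v : S) := by
  simp [twistedMul]

/-- The possible common values on `N` of tensors vanishing at `g` form an ideal of `S^N`. The tensor
`gs ⊗ 1 - 1 ⊗ s` contributes `gs - s`, and such differences avoid any given maximal ideal for a
suitable `s`, so the ideal contains `1`. -/
theorem exists_twistedMul_eq (hN : ∀ Q : Ideal S, Q.IsMaximal → Q.inertia G ≤ N)
    {g : G} (hg : g ∉ N) : ∃ T : FixedPoints.subring S N ⊗[ℤ] FixedPoints.subring S N,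
      (∀ h ∈ N, twistedMul N h T = 1) ∧ twistedMul N g T = 0 := by
  let J : Ideal (FixedPoints.subring S N) :=
    { carrier := {t | ∃ T : FixedPoints.subring S N ⊗[ℤ] FixedPoints.subring S N,
        (∀ h ∈ N, twistedMul N h T = t) ∧ twistedMul N g T = 0}
      add_mem' := by
        rintro a b ⟨T, hT, hT'⟩ ⟨U, hU, hU'⟩
        exact ⟨T + U, fun h hh => by rw [map_add, hT h hh, hU h hh]; rfl,
          by rw [map_add, hT', hU', add_zero]⟩
      zero_mem' := ⟨0, fun h hh => by simp, by simp⟩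
      smul_mem' := by
        rintro c a ⟨T, hT, hT'⟩
        refine ⟨(c ⊗ₜ 1) * T, fun h hh => ?_, by rw [map_mul, hT', mul_zero]⟩
        rw [map_mul, hT h hh, twistedMul_tmul]
        simp }
  have hJ : J = ⊤ := by
    by_contra hne
    obtain ⟨m, hm, hJm⟩ := Ideal.exists_le_maximal J hne
    obtain ⟨s, hs⟩ := exists_smul_sub_notMem N hN hg m
    have hgs : g • (s : S) ∈ FixedPoints.subring S N := fun h =>
      smul_mem_of_fixed N (fun k hk => s.2 ⟨k, hk⟩) g h h.2
    refine hs (⟨g • (s : S), hgs⟩ - s) rfl (hJm ?_)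
    refine ⟨⟨g • (s : S), hgs⟩ ⊗ₜ 1 - 1 ⊗ₜ s, fun h hh => ?_, ?_⟩
    · rw [map_sub, twistedMul_tmul, twistedMul_tmul]
      simp [show h • (s : S) = s from s.2 ⟨h, hh⟩]
    · rw [map_sub, twistedMul_tmul, twistedMul_tmul]
      simp
  have h1 : (1 : FixedPoints.subring S N) ∈ J := hJ ▸ Submodule.mem_top
  obtain ⟨T, hT, hT'⟩ := h1
  exact ⟨T, fun h hh => by rw [hT h hh]; rfl, hT'⟩

/-- If all inertia groups are contained in the normal subgroup `N`, then `S^N` is a Galois ring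
extension with group `G / N`. -/
theorem exists_galois_coordinates (hN : ∀ Q : Ideal S, Q.IsMaximal → Q.inertia G ≤ N) :
    ∃ (n : ℕ) (u v : Fin n → FixedPoints.subring S N), ∀ g : G,
      (g ∈ N → ∑ i, (u i : S) * g • (v i : S) = 1) ∧
      (g ∉ N → ∑ i, (u i : S) * g • (v i : S) = 0) := by
  classical
  cases nonempty_fintype G
  have h0 := fun g : {g : G // g ∉ N} => exists_twistedMul_eq N hN g.2
  choose T hT hT' using h0
  -- Each `twistedMul N g` is multiplicative, so the product over all `g ∉ N` is `1` on `N` and `0`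
  -- off it.
  obtain ⟨n, u, v, huv⟩ := TensorProduct.exists_sum_tmul_eq (∏ g, T g)
  have key : ∀ g : G, ∑ i, (u i : S) * g • (v i : S) = ∏ g', twistedMul N g (T g') := by
    intro g
    rw [← map_prod, huv, map_sum]
    exact Finset.sum_congr rfl fun i _ => (twistedMul_tmul N g _ _).symm
  refine ⟨n, u, v, fun g => ⟨fun hg => ?_, fun hg => ?_⟩⟩
  · rw [key]
    exact Finset.prod_eq_one fun g' _ => hT g' g hg
  · rw [key]
    exact Finset.prod_eq_zero (Finset.mem_univ ⟨g, hg⟩) (hT' ⟨g, hg⟩)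

end GaloisCoordinates

/-! ### Units in group rings of `p`-groups. -/

section PGroup

variable {S Γ : Type*} [CommRing S] [CommGroup Γ] [Fintype Γ]

/-- In the group ring of a finite commutative `p`-group over a ring whose residue fields have
characteristic `p`, an element with invertible augmentation is invertible. -/
theorem MonoidAlgebra.isUnit_of_isUnit_augmentation (p : ℕ) [Fact p.Prime]
    (hp : ∀ m : Ideal S, m.IsMaximal → (p : S) ∈ m) (hΓ : IsPGroup p Γ) (c : Γ → S)
    (hc : IsUnit (∑ γ, c γ)) : IsUnit (∑ γ, MonoidAlgebra.single γ (c γ)) := by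
  by_contra hcon
  obtain ⟨m, hm, hmem⟩ := exists_max_ideal_of_mem_nonunits hcon
  have : Module.Finite S (MonoidAlgebra S Γ) := inferInstance
  have hI : Algebra.IsIntegral S (MonoidAlgebra S Γ) := inferInstance
  have hmS := Ideal.isMaximal_comap_of_isIntegral_of_isMaximal (R := S) m
  let := Ideal.Quotient.field m
  have hp0 : ((p : ℕ) : MonoidAlgebra S Γ ⧸ m) = 0 := by
    have h1 := Ideal.mem_comap.1 (hp _ hmS)
    rw [map_natCast] at h1
    rw [← map_natCast (Ideal.Quotient.mk m)]
    exact Ideal.Quotient.eq_zero_iff_mem.2 h1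
  have : CharP (MonoidAlgebra S Γ ⧸ m) p := 
    (CharP.charP_iff_prime_eq_zero Fact.out).2 hp0
  -- In a field of characteristic `p` the only `p`-power root of unity is `1`; thus reduction modulo
  -- `m` factors through the augmentation.
  have hone : ∀ γ : Γ, Ideal.Quotient.mk m (MonoidAlgebra.single γ 1) = 1 := by
    intro γ
    obtain ⟨k, hk⟩ := hΓ γ
    have h2 : (Ideal.Quotient.mk m (MonoidAlgebra.single γ 1)) ^ p ^ k = 1 := by
      rw [← map_pow, MonoidAlgebra.single_pow, hk, one_pow, ← MonoidAlgebra.one_def, map_one]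
    have h3 : (Ideal.Quotient.mk m (MonoidAlgebra.single γ 1) - 1) ^ p ^ k = 0 := by
      rw [sub_pow_char_pow, h2, one_pow, sub_self]
    exact sub_eq_zero.1 (pow_eq_zero_iff (pow_ne_zero _ (Fact.out : p.Prime).ne_zero) |>.1 h3)
  have h4 : Ideal.Quotient.mk m (∑ γ, MonoidAlgebra.single γ (c γ)) =
      Ideal.Quotient.mk m (algebraMap S _ (∑ γ, c γ)) := by
    rw [map_sum, map_sum, map_sum]
    refine Finset.sum_congr rfl fun γ _ => ?_
    have : MonoidAlgebra.single γ (c γ) =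
        algebraMap S (MonoidAlgebra S Γ) (c γ) * MonoidAlgebra.single γ 1 := by
      simp
    rw [this, map_mul, hone, mul_one]
  rw [Ideal.Quotient.eq_zero_iff_mem.2 hmem] at h4
  exact ((hc.map (algebraMap S _)).map (Ideal.Quotient.mk m)).ne_zero h4.symm

end PGroup

/-! ### Integrality of traces and of group algebra coefficients. -/

section Trace

/-- The trace of an endomorphism that is integral over `R` is integral over `R`. -/
theorem Module.End.isIntegral_trace {R L V : Type*} [CommRing R] [Field L] [Algebra R L]
    [AddCommGroup V] [Module L V] [FiniteDimensional L V] (f : Module.End L V)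
    (p : Polynomial R) (hp : p.Monic) (hf : Polynomial.aeval f (p.map (algebraMap R L)) = 0) :
    IsIntegral R (LinearMap.trace L V f) := by
  classical
  -- Over an algebraic closure the trace is a sum of eigenvalues, each of which is a root of `p`.
  let Ω := AlgebraicClosure L
  let f' : Module.End Ω (Ω ⊗[L] V) := f.baseChange Ω
  have htr : LinearMap.trace Ω _ f' = algebraMap L Ω (LinearMap.trace L V f) :=
    LinearMap.trace_baseChange f Ω
  rw [← isIntegral_algebraMap_iff (algebraMap L Ω).injective, ← htr,
    Module.End.trace_eq_sum_roots_charpoly_of_splits (IsAlgClosed.splits _)]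
  refine IsIntegral.multiset_sum fun μ hμ => ⟨p, hp, ?_⟩
  have h1 : f'.HasEigenvalue μ := by
    rw [Module.End.hasEigenvalue_iff_isRoot_charpoly]
    exact Polynomial.isRoot_of_mem_roots hμ
  obtain ⟨v, hv⟩ := h1.exists_hasEigenvector
  have h2 : Polynomial.aeval f' (p.map (algebraMap R Ω)) = 0 := by
    have h3 : Polynomial.aeval f' (p.map (algebraMap R Ω)) =
        Module.End.baseChangeHom L Ω V (Polynomial.aeval f (p.map (algebraMap R L))) := by
      rw [← Polynomial.aeval_algHom_apply, IsScalarTower.algebraMap_eq R L Ω, ← Polynomial.map_map,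
        Polynomial.aeval_map_algebraMap]
      rfl
    rw [h3, hf, map_zero]
  have h4 := Module.End.aeval_apply_of_hasEigenvector (p := p.map (algebraMap R Ω)) hv
  rw [h2, LinearMap.zero_apply, eq_comm, smul_eq_zero] at h4
  have h5 := h4.resolve_right hv.2
  rwa [Polynomial.eval_map] at h5

/-- Coefficients of an integral element of a commutative group algebra `L[Γ]` are integral after
multiplication by the order of `Γ`. -/
theorem MonoidAlgebra.isIntegral_card_mul_coeff {R L Γ : Type*} [CommRing R] [Field L] [Algebra R L]
    [CommGroup Γ] [Fintype Γ] (z : MonoidAlgebra L Γ) (hz : IsIntegral R z) (γ : Γ) :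
    IsIntegral R ((Fintype.card Γ : L) * z.coeff γ) := by
  classical
  have hone : ∀ w : MonoidAlgebra L Γ, LinearMap.trace L _ (Algebra.lmul L _ w) =
      (Fintype.card Γ : L) * w.coeff 1 := by
    intro w
    let b : Module.Basis Γ L (MonoidAlgebra L Γ) :=
      Module.Basis.ofRepr (MonoidAlgebra.coeffLinearEquiv L)
    rw [LinearMap.trace_eq_matrix_trace L b, Matrix.trace]
    have : ∀ δ : Γ, (LinearMap.toMatrix b b (Algebra.lmul L _ w)).diag δ = w.coeff 1 := by
      intro δ
      have hb : b δ = MonoidAlgebra.single δ 1 := rfl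
      rw [Matrix.diag_apply, LinearMap.toMatrix_apply, hb]
      change (w * MonoidAlgebra.single δ 1).coeff δ = _
      simp
    rw [Finset.sum_congr rfl fun δ _ => this δ]
    simp
  -- Multiplying `z` by `γ⁻¹`, which is integral as an element of finite order, moves the
  -- coefficient of `γ` to `1`, where the trace of the regular representation detects it.
  have h1 : IsIntegral R (MonoidAlgebra.single γ⁻¹ (1 : L)) := by
    refine IsIntegral.of_pow (n := Fintype.card Γ) Fintype.card_pos ?_
    rw [MonoidAlgebra.single_pow, pow_card_eq_one, one_pow, ← MonoidAlgebra.one_def]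
    exact isIntegral_one
  obtain ⟨p, hp, hp0⟩ := hz.mul h1
  have h2 := Module.End.isIntegral_trace (Algebra.lmul L _ (z * MonoidAlgebra.single γ⁻¹ (1 : L)))
    p hp (by
      rw [Polynomial.aeval_algHom_apply, Polynomial.aeval_map_algebraMap]
      rw [← Polynomial.aeval_def] at hp0
      rw [hp0, map_zero])
  rw [hone] at h2
  simpa using h2

end Trace

/-! ### Lattices over the maximal order of a finite reduced algebra. -/

section MaximalOrder

/-- An element of a finite product is integral if all its components are. -/
theorem IsIntegral.of_forall_apply {R ι : Type*} [CommRing R] [Finite ι] {A : ι → Type*}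
    [∀ i, CommRing (A i)] [∀ i, Algebra R (A i)] {x : ∀ i, A i} (hx : ∀ i, IsIntegral R (x i)) :
    IsIntegral R x := by
  cases nonempty_fintype ι
  choose p hp hp' using hx
  refine ⟨∏ i, p i, Polynomial.monic_prod_of_monic _ _ fun i _ => hp i, ?_⟩
  rw [← Polynomial.aeval_def]
  ext i
  have h1 := Polynomial.aeval_algHom_apply (Pi.evalAlgHom R A i) x (∏ i, p i)
  change _ = (Polynomial.aeval x (∏ i, p i)) i at h1
  rw [← h1, map_prod, Pi.zero_apply]
  exact Finset.prod_eq_zero (Finset.mem_univ i) (hp' i)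

variable {R K : Type*} [CommRing R] [IsDomain R] [IsDiscreteValuationRing R] [Field K]
  [Algebra R K] [IsFractionRing R K] [CharZero K]

include K in
/-- A finitely generated module over the integral closure of a discrete valuation ring in a finite
field extension is cyclic, if it is contained in the field. -/
theorem exists_generator_of_field (F : Type*) [Field F] [Algebra K F] [FiniteDimensional K F]
    [Algebra R F] [IsScalarTower R K F] (J : Submodule R F) (hfg : J.FG)
    (hJ : ∀ a : F, IsIntegral R a → ∀ x ∈ J, a * x ∈ J) :
    ∃ j ∈ J, ∀ x ∈ J, ∃ a, IsIntegral R a ∧ x = a * j := by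
  have : IsDedekindDomain (integralClosure R F) := integralClosure.isDedekindDomain R K F
  have : IsFractionRing (integralClosure R F) F :=
    IsIntegralClosure.isFractionRing_of_finite_extension R K F _
  have : Module.Finite R (integralClosure R F) := IsIntegralClosure.finite R K F _
  -- A Dedekind domain with finitely many maximal ideals is principal; here all of them lie over the
  -- maximal ideal of `R`.
  have hpid : IsPrincipalIdealRing (integralClosure R F) := by
    refine IsPrincipalIdealRing.of_finite_maximals ?_
    refine (Algebra.QuasiFinite.finite_primesOver (S := integralClosure R F)
      (IsLocalRing.maximalIdeal R)).subset ?_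
    intro I hI
    have hI' : I.IsMaximal := hI
    have := Ideal.isMaximal_comap_of_isIntegral_of_isMaximal (R := R) I
    exact ⟨hI'.isPrime, ⟨(IsLocalRing.eq_maximalIdeal this).symm⟩⟩
  let J' : Submodule (integralClosure R F) F :=
    { J with smul_mem' := fun a x hx => hJ a a.2 x hx }
  have hfg' : J'.FG := by
    obtain ⟨s, hs⟩ := hfg
    refine ⟨s, le_antisymm (Submodule.span_le.2 fun x hx => ?_) fun x hx => ?_⟩
    · exact (hs ▸ Submodule.subset_span hx : x ∈ J)
    · have hx' : x ∈ Submodule.span R (s : Set F) := hs ▸ hx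
      exact Submodule.span_le_restrictScalars R (integralClosure R F) _ hx'
  have hfrac : IsFractional (integralClosure R F)⁰ J' := FractionalIdeal.isFractional_of_fg hfg'
  have hprin := FractionalIdeal.isPrincipal (K := F) (⟨J', hfrac⟩ :
    FractionalIdeal (integralClosure R F)⁰ F)
  obtain ⟨j, hj⟩ := hprin.principal
  have hj' : J' = Submodule.span (integralClosure R F) {j} := hj
  refine ⟨j, ?_, fun x hx => ?_⟩
  · have : j ∈ J' := hj' ▸ Submodule.mem_span_singleton_self j
    exact this
  · have : x ∈ J' := hx
    rw [hj', Submodule.mem_span_singleton] at this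
    obtain ⟨a, ha⟩ := this
    exact ⟨a, a.2, ha.symm⟩

include K in
/-- A finitely generated module over the integral closure of a discrete valuation ring in a finite
reduced commutative algebra is cyclic, if it is contained in the algebra. -/
theorem exists_generator_of_isReduced (H : Type*) [CommRing H] [Algebra K H] [Module.Finite K H]
    [IsReduced H] [Algebra R H] [IsScalarTower R K H] (J : Submodule R H) (hfg : J.FG)
    (hJ : ∀ a : H, IsIntegral R a → ∀ x ∈ J, a * x ∈ J) :
    ∃ j ∈ J, ∀ x ∈ J, ∃ a, IsIntegral R a ∧ x = a * j := by
  classical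
  have hart : IsArtinianRing H := IsArtinianRing.of_finite K H
  cases nonempty_fintype (MaximalSpectrum H)
  let e := IsArtinianRing.equivPi H
  have he : ∀ (h : H) (m : MaximalSpectrum H), e h m = Ideal.Quotient.mk m.asIdeal h :=
    fun h m => rfl
  have hint : ∀ h : H, (∀ m, IsIntegral R (e h m)) → IsIntegral R h := by
    intro h hh
    let E : H →ₐ[R] (∀ m : MaximalSpectrum H, H ⧸ m.asIdeal) :=
      { e.toRingHom with commutes' := fun r => rfl }
    rw [← isIntegral_algHom_iff E e.injective]
    exact IsIntegral.of_forall_apply hh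
  have hint' : ∀ h m, IsIntegral R h → IsIntegral R (e h m) := by
    intro h m hh
    exact hh.map (Ideal.Quotient.mkₐ R m.asIdeal)
  let q : ∀ m : MaximalSpectrum H, H →ₗ[R] H ⧸ m.asIdeal :=
    fun m => (Ideal.Quotient.mkₐ R m.asIdeal).toLinearMap
  have hq : ∀ m h, q m h = e h m := fun m h => rfl
  have hloc : ∀ m : MaximalSpectrum H, ∃ j ∈ J, ∀ x ∈ J, ∃ a : H, IsIntegral R a ∧
      e x m = e a m * e j m := by
    intro m
    let := Ideal.Quotient.field m.asIdeal
    obtain ⟨j, hj, hj'⟩ := exists_generator_of_field (K := K) (H ⧸ m.asIdeal) (J.map (q m))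
      (hfg.map _) (by
        rintro a ha _ ⟨x, hx, rfl⟩
        obtain ⟨b, hb⟩ := e.surjective (Pi.single m a)
        have hbi : IsIntegral R b := by
          refine hint b fun m' => ?_
          rw [hb]
          by_cases h : m' = m
          · subst h; simpa using ha
          · rw [Pi.single_eq_of_ne h]; exact isIntegral_zero
        refine ⟨b * x, hJ b hbi x hx, ?_⟩
        rw [hq, hq, map_mul, Pi.mul_apply, hb, Pi.single_eq_same])
    obtain ⟨j, hjJ, rfl⟩ := hj
    refine ⟨j, hjJ, fun x hx => ?_⟩
    obtain ⟨a, ha, hxa⟩ := hj' (q m x) ⟨x, hx, rfl⟩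
    obtain ⟨b, hb⟩ := e.surjective (Pi.single m a)
    refine ⟨b, ?_, ?_⟩
    · refine hint b fun m' => ?_
      rw [hb]
      by_cases h : m' = m
      · subst h; simpa using ha
      · rw [Pi.single_eq_of_ne h]; exact isIntegral_zero
    · rw [hb, Pi.single_eq_same]; exact hxa
  -- The idempotents `ε m` of the decomposition into fields are integral, so they preserve `J` and
  -- glue the generators of the components.
  choose j hj hj' using hloc
  choose ε hε using fun m => e.surjective (Pi.single m 1)
  have hεi : ∀ m, IsIntegral R (ε m) := by
    intro m
    refine hint _ fun m' => ?_
    rw [hε]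
    by_cases h : m' = m
    · subst h; simpa using isIntegral_one
    · rw [Pi.single_eq_of_ne h]; exact isIntegral_zero
  have hsum : ∀ (c : MaximalSpectrum H → H) m, e (∑ m', ε m' * c m') m = e (c m) m := by
    intro c m
    rw [map_sum, Finset.sum_apply, Finset.sum_eq_single m]
    · rw [map_mul, Pi.mul_apply, hε, Pi.single_eq_same, one_mul]
    · intro m' _ hm'
      rw [map_mul, Pi.mul_apply, hε, Pi.single_eq_of_ne hm'.symm, zero_mul]
    · simp
  refine ⟨∑ m, ε m * j m, J.sum_mem fun m _ => hJ _ (hεi m) _ (hj m), fun x hx => ?_⟩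
  choose a ha ha' using fun m => hj' m x hx
  refine ⟨∑ m, ε m * a m, IsIntegral.sum _ fun m _ => (hεi m).mul (ha m), e.injective ?_⟩
  ext m
  rw [map_mul, Pi.mul_apply, hsum, hsum]
  exact ha' m

end MaximalOrder

/-! ### Matching decompositions of `N` and of the Galois group. -/

namespace HopfGaloisModule

namespace GPSubgroup

variable {K L : Type*} [Field K] [Field L] [Algebra K L] (P : GPSubgroup K L)

theorem conj_apply (g : Gal(L/K)) (η : P.N) (x : Gal(L/K)) :
    (P.conj g η : Equiv.Perm Gal(L/K)) x = g * (η : Equiv.Perm Gal(L/K)) (g⁻¹ * x) := by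
  simp [conj]

theorem eq_of_apply_one_eq {η μ : P.N}
    (h : (η : Equiv.Perm Gal(L/K)) 1 = (μ : Equiv.Perm Gal(L/K)) 1) : η = μ :=
  (P.regular 1 _).unique h rfl

theorem exists_apply_one_eq (g : Gal(L/K)) : ∃ η : P.N, (η : Equiv.Perm Gal(L/K)) 1 = g :=
  (P.regular 1 g).exists

theorem conj_injective (g : Gal(L/K)) : Function.Injective (P.conj g) := by
  intro η μ h
  ext x
  have := congrArg (fun ν : P.N => (ν : Equiv.Perm Gal(L/K)) (g * x)) h
  simp only [conj_apply, inv_mul_cancel_left, mul_left_cancel_iff] at this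
  rw [this]

/-- The orbit of `1` under a subgroup of `N` that is stable under conjugation by translations. -/
def orbit (M : Subgroup P.N) (hM : ∀ g, ∀ η ∈ M, P.conj g η ∈ M) : Subgroup Gal(L/K) where
  carrier := {g | ∃ η ∈ M, (η : Equiv.Perm Gal(L/K)) 1 = g}
  one_mem' := ⟨1, M.one_mem, rfl⟩
  mul_mem' := by
    rintro _ _ ⟨η, hη, rfl⟩ ⟨μ, hμ, rfl⟩
    -- With `a = η 1`, conjugating `μ` by translation by `a` gives a permutation carrying `a` to `a
    -- * μ 1`.
    refine ⟨P.conj ((η : Equiv.Perm Gal(L/K)) 1) μ * η, M.mul_mem (hM _ _ hμ) hη, ?_⟩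
    rw [Subgroup.coe_mul, Equiv.Perm.mul_apply, conj_apply, inv_mul_cancel]
  inv_mem' := by
    rintro _ ⟨η, hη, rfl⟩
    refine ⟨P.conj ((η : Equiv.Perm Gal(L/K)) 1)⁻¹ η⁻¹, hM _ _ (M.inv_mem hη), ?_⟩
    rw [conj_apply, inv_inv, mul_one, Subgroup.coe_inv, Equiv.Perm.inv_def,
      Equiv.symm_apply_apply, mul_one]

/-- `i` embeds `Γ` as a subgroup of `N` that is stable under conjugation by translations, with
orbit `G₁`, and that is centralized by a complement `G₂` of `G₁`. -/
structure IsFactor {Γ : Type*} [Group Γ] (i : Γ →* P.N) (G₁ G₂ : Subgroup Gal(L/K)) : Prop where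
  injective : Function.Injective i
  stable (g : Gal(L/K)) (γ : Γ) : ∃ γ', P.conj g (i γ) = i γ'
  apply_one_mem (γ : Γ) : (i γ : Equiv.Perm Gal(L/K)) 1 ∈ G₁
  exists_apply_one (g : Gal(L/K)) (hg : g ∈ G₁) : ∃ γ, (i γ : Equiv.Perm Gal(L/K)) 1 = g
  central (g : Gal(L/K)) (hg : g ∈ G₂) (γ : Γ) : P.conj g (i γ) = i γ
  exists_mul (g : Gal(L/K)) : ∃ g₁ ∈ G₁, ∃ g₂ ∈ G₂, g = g₁ * g₂

section Complement

variable (hG : ∀ g h : Gal(L/K), g * h = h * g) (hN : ∀ η μ : P.N, η * μ = μ * η)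
  {M M' : Subgroup P.N} (hM : ∀ g, ∀ η ∈ M, P.conj g η ∈ M)
  (hM' : ∀ g, ∀ η ∈ M', P.conj g η ∈ M') (hdis : ∀ η ∈ M, η ∈ M' → η = 1)

include hdis in
theorem eq_one_of_mem_orbit {g : Gal(L/K)} (hg : g ∈ P.orbit M hM) (hg' : g ∈ P.orbit M' hM') :
    g = 1 := by
  obtain ⟨η, hη, rfl⟩ := hg
  obtain ⟨μ, hμ, h⟩ := hg'
  have := P.eq_of_apply_one_eq h
  rw [hdis η hη (this ▸ hμ)]
  rfl

-- Put `a = η 1` and let `b` be the image of `1` under the conjugate of `η`. Then `a⁻¹ * b` lies in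
-- the orbit of `M`, and commutativity of `N` and `G` rewrites it as an element of the orbit of
-- `M'`. Hence `a = b`, and regularity of `N` concludes.
include hG hN hM hdis in
theorem conj_eq_self {g : Gal(L/K)} (hg : g ∈ P.orbit M' hM') {η : P.N} (hη : η ∈ M) :
    P.conj g η = η := by
  have hg' := (P.orbit M' hM').inv_mem hg
  obtain ⟨μ, hμ, hμg⟩ := hg'
  refine P.eq_of_apply_one_eq ?_
  set a := (η : Equiv.Perm Gal(L/K)) 1 with ha
  have h1 : (η : Equiv.Perm Gal(L/K)) g⁻¹ = a * (P.conj a⁻¹ μ : Equiv.Perm Gal(L/K)) 1 := by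
    rw [conj_apply, inv_inv, mul_one, mul_inv_cancel_left, ha, ← hμg, ← Equiv.Perm.mul_apply,
      ← Equiv.Perm.mul_apply, ← Subgroup.coe_mul, ← Subgroup.coe_mul, hN]
  have h2 : (P.conj g η : Equiv.Perm Gal(L/K)) 1 = g * (η : Equiv.Perm Gal(L/K)) g⁻¹ := by
    rw [conj_apply, mul_one]
  rw [h1] at h2
  set b := (P.conj g η : Equiv.Perm Gal(L/K)) 1 with hb
  have h3 : a⁻¹ * b = g * (P.conj a⁻¹ μ : Equiv.Perm Gal(L/K)) 1 := by
    rw [h2, ← mul_assoc g a, hG g a, mul_assoc, inv_mul_cancel_left]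
  have h4 : a⁻¹ * b = 1 := by
    refine P.eq_one_of_mem_orbit hM hM' hdis ?_ ?_
    · exact (P.orbit M hM).mul_mem ((P.orbit M hM).inv_mem ⟨η, hη, rfl⟩)
        ⟨_, hM g η hη, rfl⟩
    · rw [h3]
      exact (P.orbit M' hM').mul_mem hg ⟨_, hM' _ _ hμ, rfl⟩
  exact (inv_mul_eq_one.1 h4).symm

include hG hN hdis in
theorem isFactor_of_isComplement (hprod : ∀ η, ∃ μ ∈ M, ∃ μ' ∈ M', η = μ * μ') :
    P.IsFactor M.subtype (P.orbit M hM) (P.orbit M' hM') where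
  injective := M.subtype_injective
  stable g γ := ⟨⟨P.conj g γ, hM g γ γ.2⟩, rfl⟩
  apply_one_mem γ := ⟨γ, γ.2, rfl⟩
  exists_apply_one := by
    rintro g ⟨η, hη, rfl⟩
    exact ⟨⟨η, hη⟩, rfl⟩
  central g hg γ := P.conj_eq_self hG hN hM hM' hdis hg γ.2
  exists_mul g := by
    obtain ⟨η, rfl⟩ := P.exists_apply_one_eq g
    obtain ⟨μ, hμ, μ', hμ', rfl⟩ := hprod η
    set a := (μ' : Equiv.Perm Gal(L/K)) 1 with ha
    -- Here `μ a = a * (P.conj a⁻¹ μ) 1`, and commutativity of the Galois group reorders the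
    -- factors.
    refine ⟨(P.conj a⁻¹ μ : Equiv.Perm Gal(L/K)) 1, ⟨_, hM _ _ hμ, rfl⟩, a, ⟨_, hμ', rfl⟩, ?_⟩
    rw [conj_apply, hG, inv_inv, mul_one, mul_inv_cancel_left]
    rfl

end Complement

/-! ### Resolvents. -/

section Resolvent

variable {Γ : Type*} [CommGroup Γ] [Fintype Γ] (i : Γ →* P.N)

/-- The homomorphism `L[Γ] → L[N]` induced by `i : Γ → N`. -/
noncomputable def incl : MonoidAlgebra L Γ →ₐ[L] P.GroupAlgebra :=
  MonoidAlgebra.mapDomainAlgHom L L i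

omit [Fintype Γ] in
theorem incl_single (γ : Γ) (c : L) :
    P.incl i (MonoidAlgebra.single γ c) = MonoidAlgebra.single (i γ) c := by
  simp [incl]

/-- The sum of all `(γ(1))(y) γ` for `γ : Γ`. -/
noncomputable def resolvent (y : L) : MonoidAlgebra L Γ :=
  ∑ γ, MonoidAlgebra.single γ ((i γ : Equiv.Perm Gal(L/K)) 1 y)

/-- Only `γ = ν⁻¹` pairs with `ν` to give `1`, which matches the inverse in the definition of `act`.
This translates the action on `y` into multiplication by the resolvent, so that invertibility of the
resolvent controls both generation and annihilators. -/
theorem coeff_mul_resolvent (z : MonoidAlgebra L Γ) (y : L) :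
    (z * P.resolvent i y).coeff 1 = P.act (P.incl i z) y := by
  classical
  induction z using MonoidAlgebra.induction_linear with
  | zero => simp
  | add a b ha hb => simp [add_mul, ha, hb]
  | single ν c =>
    rw [incl_single, act_single, resolvent, Finset.mul_sum]
    simp_rw [MonoidAlgebra.single_mul_single]
    rw [MonoidAlgebra.coeff_sum, Finsupp.finsetSum_apply, Finset.sum_eq_single ν⁻¹]
    · simp
    · intro γ _ hγ
      have : ν * γ ≠ 1 := fun h => hγ (eq_inv_of_mul_eq_one_right h)
      simp [this]
    · simp

theorem coeff_resolvent (y : L) (γ : Γ) :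
    (P.resolvent i y).coeff γ = (i γ : Equiv.Perm Gal(L/K)) 1 y := by
  classical
  rw [resolvent, MonoidAlgebra.coeff_sum, Finsupp.finsetSum_apply, Finset.sum_eq_single γ]
  · simp
  · intro δ _ hδ
    simp [hδ]
  · simp

variable {i} {G₁ G₂ : Subgroup Gal(L/K)} (hi : P.IsFactor i G₁ G₂)

include hi

/-- Conjugating `γ` by `g = ν 1` gives some `τ γ` with `(τ γ * ν) 1 = g * γ 1`, so the resolvent is
reindexed along the bijection `γ ↦ τ γ * ν`. -/
theorem galAct_incl_resolvent (y : L) {g : Gal(L/K)} {ν : Γ}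
    (hν : (i ν : Equiv.Perm Gal(L/K)) 1 = g) :
    P.galAct g (P.incl i (P.resolvent i y)) =
      P.incl i (P.resolvent i y * MonoidAlgebra.single ν⁻¹ 1) := by
  choose τ hτ using hi.stable g
  have hτi : Function.Injective fun γ => τ γ * ν := by
    intro a b h
    have h1 : τ a = τ b := mul_right_cancel h
    have h2 := hτ a
    rw [h1, ← hτ b] at h2
    exact hi.injective (P.conj_injective g h2)
  have hτb : Function.Bijective fun γ => τ γ * ν := Finite.injective_iff_bijective.1 hτi
  rw [resolvent, Finset.sum_mul]
  simp_rw [MonoidAlgebra.single_mul_single, map_sum, incl_single, galAct_single]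
  refine (Finset.sum_congr rfl fun γ _ => ?_).trans (hτb.sum_comp fun γ =>
    MonoidAlgebra.single (i (γ * ν⁻¹)) ((i γ : Equiv.Perm Gal(L/K)) 1 y * 1))
  rw [mul_inv_cancel_right, hτ, mul_one, map_mul, ← hτ, Subgroup.coe_mul, Equiv.Perm.mul_apply,
    hν, conj_apply, inv_mul_cancel, AlgEquiv.mul_apply]

omit [Fintype Γ] in
theorem galAct_incl_single_one {g : Gal(L/K)} (hg : g ∈ G₂) (γ : Γ) (c : L) :
    P.galAct g (P.incl i (MonoidAlgebra.single γ c)) =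
      P.incl i (MonoidAlgebra.single γ (g c)) := by
  rw [incl_single, galAct_single, hi.central g hg, incl_single]

variable (hG : ∀ g h : Gal(L/K), g * h = h * g)

include hG in
theorem galAct_incl_resolvent_of_mem {y : L} (hy : ∀ g ∈ G₂, g y = y) {g : Gal(L/K)}
    (hg : g ∈ G₂) : P.galAct g (P.incl i (P.resolvent i y)) = P.incl i (P.resolvent i y) := by
  rw [resolvent]
  simp_rw [map_sum]
  refine Finset.sum_congr rfl fun γ _ => ?_
  rw [P.galAct_incl_single_one hi hg, ← AlgEquiv.mul_apply, hG, AlgEquiv.mul_apply, hy g hg]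

include hG in
/-- If the resolvent of `x` is invertible, then `x` generates the elements fixed by `G₂`. -/
theorem incl_resolvent_mul_mem_fixedAlgebra {x b : L} (hx : ∀ g ∈ G₂, g x = x)
    (hb : ∀ g ∈ G₂, g b = b) {W : MonoidAlgebra L Γ} (hW : W * P.resolvent i x = 1) :
    P.incl i (P.resolvent i b * W) ∈ P.fixedAlgebra := by
  rw [P.mem_fixedAlgebra]
  -- If `g` multiplies the resolvents of `x` and `b` by the same group element, that element cancels
  -- in the quotient of the resolvents. For `g` in `G₁` the element is `ν⁻¹` with `ν 1 = g`; for `g`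
  -- in `G₂` it is `1`.
  have key : ∀ (g : Gal(L/K)) (ν : Γ),
      (∀ y : L, (∀ g ∈ G₂, g y = y) → P.galAct g (P.incl i (P.resolvent i y)) =
        P.incl i (P.resolvent i y * MonoidAlgebra.single ν⁻¹ 1)) →
      P.galAct g (P.incl i (P.resolvent i b * W)) = P.incl i (P.resolvent i b * W) := by
    intro g ν h
    have hνν : (MonoidAlgebra.single ν⁻¹ 1 * MonoidAlgebra.single ν 1 : MonoidAlgebra L Γ) = 1 := by
      simp [MonoidAlgebra.one_def]
    have h1 : P.galAct g (P.incl i W) = P.incl i (W * MonoidAlgebra.single ν 1) := by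
      have h2 : P.galAct g (P.incl i W) *
          P.incl i (P.resolvent i x * MonoidAlgebra.single ν⁻¹ 1) = 1 := by
        rw [← h x hx, ← map_mul, ← map_mul, hW, map_one, map_one]
      have h3 : P.incl i (P.resolvent i x * MonoidAlgebra.single ν⁻¹ 1) *
          P.incl i (W * MonoidAlgebra.single ν 1) = 1 := by
        rw [← map_mul, mul_mul_mul_comm, mul_comm _ W, hW, hνν, one_mul, map_one]
      exact left_inv_eq_right_inv h2 h3
    rw [map_mul, map_mul, h b hb, h1, ← map_mul, mul_mul_mul_comm, hνν, mul_one, map_mul]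
  intro g
  obtain ⟨g₁, hg₁, g₂, hg₂, rfl⟩ := hi.exists_mul g
  obtain ⟨ν, hν⟩ := hi.exists_apply_one g₁ hg₁
  have h1 := key g₁ ν fun y _ => P.galAct_incl_resolvent hi y hν
  have h2 := key g₂ 1 fun y hy => by
    rw [P.galAct_incl_resolvent_of_mem hi hG hy hg₂, inv_one, ← MonoidAlgebra.one_def, mul_one]
  have h3 : ∀ z, P.galAct (g₁ * g₂) z = P.galAct g₁ (P.galAct g₂ z) := by
    intro z
    induction z using MonoidAlgebra.induction_linear with
    | zero => simp
    | add a b ha hb => simp only [map_add, ha, hb]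
    | single η c =>
      rw [galAct_single, galAct_single, galAct_single]
      congr 1
  rw [h3, h2, h1]

-- The product of the acting element with the resolvent of `x` is the resolvent of `b`, whose
-- coefficient at `1` is `b`.
omit hi in
theorem act_incl_resolvent_mul {x b : L} {W : MonoidAlgebra L Γ} (hW : W * P.resolvent i x = 1) :
    P.act (P.incl i (P.resolvent i b * W)) x = b := by
  rw [← coeff_mul_resolvent, mul_assoc, hW, mul_one, coeff_resolvent, map_one i]
  rfl

/-- If the resolvent of `y` is invertible, then `y` has trivial annihilator. -/
theorem eq_zero_of_act_incl_eq_zero {y : L} (hy : IsUnit (P.resolvent i y)) {z : MonoidAlgebra L Γ}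
    (hz : P.incl i z ∈ P.fixedAlgebra) (h : P.act (P.incl i z) y = 0) : z = 0 := by
  rw [P.mem_fixedAlgebra] at hz
  have hinj : Function.Injective (P.incl i) := by
    intro a b hab
    exact MonoidAlgebra.mapDomain_injective hi.injective hab
  suffices h0 : z * P.resolvent i y = 0 from (hy.mul_left_eq_zero).1 h0
  ext γ
  rw [← coeff_mul_resolvent] at h
  set g := (i γ : Equiv.Perm Gal(L/K)) 1 with hg
  -- Since `z` is fixed, Galois translation of the product makes its coefficient at `γ` the
  -- `g`-conjugate of its coefficient at `1`, which vanishes by hypothesis.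
  have h1 : P.galAct g (P.incl i (z * P.resolvent i y)) =
      P.incl i (z * P.resolvent i y * MonoidAlgebra.single γ⁻¹ 1) := by
    rw [map_mul, map_mul, hz, P.galAct_incl_resolvent hi y hg.symm, ← map_mul, mul_assoc]
  have h2 : ∀ w : MonoidAlgebra L Γ, (P.galAct g (P.incl i w)).coeff 1 = g (w.coeff 1) := by
    intro w
    classical
    induction w using MonoidAlgebra.induction_linear with
    | zero => simp
    | add a b ha hb => simp only [map_add, MonoidAlgebra.coeff_add, Finsupp.add_apply, ha, hb]
    | single η c =>
      rw [incl_single, galAct_single]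
      by_cases hη : η = 1
      · subst hη; simp
      · have : P.conj g (i η) ≠ 1 := fun h => hη (hi.injective (by
          rw [map_one]
          exact P.conj_injective g (by rw [h, map_one])))
        simp [this, hη]
  have h3 : ∀ w : MonoidAlgebra L Γ, (P.incl i w).coeff 1 = w.coeff 1 := by
    intro w
    classical
    induction w using MonoidAlgebra.induction_linear with
    | zero => simp
    | add a b ha hb => simp only [map_add, MonoidAlgebra.coeff_add, Finsupp.add_apply, ha, hb]
    | single η c =>
      rw [incl_single]
      by_cases hη : η = 1
      · subst hη; simp
      · have : i η ≠ 1 := fun h => hη (hi.injective (by rw [map_one, h]))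
        simp [this, hη]
  have h4 := congrArg (fun w => w.coeff 1) h1
  simp only [h2, h3, h, map_zero] at h4
  simpa using h4.symm

end Resolvent

end GPSubgroup

end HopfGaloisModule

/-! ### Integral coefficients and traces over subgroups. -/

namespace HopfGaloisModule

section IntegralCoefficients

variable (R L Γ : Type*) [CommRing R] [Field L] [Algebra R L] [Group Γ]

/-- The elements of `L[Γ]` with coefficients integral over `R`. -/
noncomputable def integralCoeff : Subalgebra R (MonoidAlgebra L Γ) :=
  (MonoidAlgebra.mapAlgHom Γ (integralClosure R L).val).range

variable {R L Γ}

theorem mem_integralCoeff [Fintype Γ] (z : MonoidAlgebra L Γ) :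
    z ∈ integralCoeff R L Γ ↔ ∀ γ, IsIntegral R (z.coeff γ) := by
  classical
  constructor
  · rintro ⟨w, rfl⟩ γ
    have : ((MonoidAlgebra.mapAlgHom Γ (integralClosure R L).val) w).coeff γ = (w.coeff γ : L) := by
      simp
    exact this ▸ (w.coeff γ).2
  · intro h
    refine ⟨∑ γ, MonoidAlgebra.single γ ⟨z.coeff γ, h γ⟩, ?_⟩
    ext γ
    simp only [map_sum, MonoidAlgebra.coeff_sum, Finsupp.finsetSum_apply]
    rw [Finset.sum_eq_single γ]
    · simp
    · intro δ _ hδ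
      simp [hδ]
    · simp

theorem single_mem_integralCoeff [Fintype Γ] (γ : Γ) {c : L} (hc : IsIntegral R c) :
    MonoidAlgebra.single γ c ∈ integralCoeff R L Γ := by
  classical
  rw [mem_integralCoeff]
  intro δ
  by_cases h : γ = δ
  · simpa [h] using hc
  · simpa [h] using isIntegral_zero

omit [Group Γ] in
theorem eq_sum_single [Fintype Γ] (z : MonoidAlgebra L Γ) :
    z = ∑ γ, MonoidAlgebra.single γ (z.coeff γ) := by
  classical
  ext δ
  rw [MonoidAlgebra.coeff_sum, Finsupp.finsetSum_apply, Finset.sum_eq_single δ]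
  · simp
  · intro γ _ h
    simp [h]
  · simp

end IntegralCoefficients

section Trace

variable {K L : Type*} [Field K] [Field L] [Algebra K L] [FiniteDimensional K L]

open Classical in
/-- The trace of `y` with respect to the group `G₁` of automorphisms. -/
noncomputable def groupTrace (G₁ : Subgroup Gal(L/K)) : L →ₗ[K] L :=
  ∑ g : G₁, ((g : Gal(L/K)) : L →ₐ[K] L).toLinearMap

open Classical in
theorem groupTrace_apply (G₁ : Subgroup Gal(L/K)) (y : L) :
    groupTrace G₁ y = ∑ g : G₁, (g : Gal(L/K)) y := by
  simp [groupTrace]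

theorem apply_groupTrace (G₁ : Subgroup Gal(L/K)) (y : L) {g : Gal(L/K)} (hg : g ∈ G₁) :
    g (groupTrace G₁ y) = groupTrace G₁ y := by
  classical
  rw [groupTrace_apply, map_sum]
  exact Fintype.sum_equiv (Equiv.mulLeft ⟨g, hg⟩) _ _ fun h => rfl

theorem apply_groupTrace_of_fixed (hG : ∀ g h : Gal(L/K), g * h = h * g) (G₁ : Subgroup Gal(L/K))
    {y : L} {g : Gal(L/K)} (hg : g y = y) : g (groupTrace G₁ y) = groupTrace G₁ y := by
  classical
  rw [groupTrace_apply, map_sum]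
  refine Finset.sum_congr rfl fun h _ => ?_
  rw [← AlgEquiv.mul_apply, hG, AlgEquiv.mul_apply, hg]

end Trace

/-! ### Galois coordinates in the fixed field and elements of trace one. -/

section GaloisCoordinates

variable {R K L : Type*} [CommRing R] [Field K] [Field L] [Algebra K L] [FiniteDimensional K L]
  [Algebra R K] [Algebra R L] [IsScalarTower R K L]

/-- If `G₂` contains the inertia groups, then the ring of integral elements fixed by `G₂` has
Galois coordinates. -/
theorem exists_galois_coordinates_of_field (G₂ : Subgroup Gal(L/K)) [G₂.Normal]
    (hin : ∀ Q : Ideal (integralClosure R L), Q.IsMaximal → ∀ g : Gal(L/K),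
      (∀ s : integralClosure R L, ∃ t ∈ Q, (t : L) = g s - s) → g ∈ G₂) :
    ∃ (n : ℕ) (u v : Fin n → L), (∀ i, IsIntegral R (u i)) ∧ (∀ i, IsIntegral R (v i)) ∧
      (∀ i, ∀ g ∈ G₂, g (u i) = u i) ∧ (∀ i, ∀ g ∈ G₂, g (v i) = v i) ∧
      ∀ g : Gal(L/K), (g ∈ G₂ → ∑ i, u i * g (v i) = 1) ∧ (g ∉ G₂ → ∑ i, u i * g (v i) = 0) := by
  let act : MulSemiringAction Gal(L/K) (integralClosure R L) :=
    { smul := fun g s => ⟨g s, s.2.map ((g : L →ₐ[K] L).restrictScalars R)⟩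
      one_smul := fun s => rfl
      mul_smul := fun g h s => rfl
      smul_zero := fun g => Subtype.ext (map_zero g)
      smul_add := fun g s t => Subtype.ext (map_add g _ _)
      smul_one := fun g => Subtype.ext (map_one g)
      smul_mul := fun g s t => Subtype.ext (map_mul g _ _) }
  have hact : ∀ (g : Gal(L/K)) (s : integralClosure R L), ((g • s : integralClosure R L) : L) =
      g s := fun g s => rfl
  obtain ⟨n, u, v, huv⟩ := exists_galois_coordinates (S := integralClosure R L) G₂ (by
    intro Q hQ g hg
    refine hin Q hQ g fun s => ⟨g • s - s, hg s, rfl⟩)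
  refine ⟨n, fun i => ((u i : integralClosure R L) : L),
    fun i => ((v i : integralClosure R L) : L), fun i => (u i : integralClosure R L).2,
    fun i => (v i : integralClosure R L).2,
    fun i g hg => congrArg Subtype.val ((u i).2 ⟨g, hg⟩),
    fun i g hg => congrArg Subtype.val ((v i).2 ⟨g, hg⟩), fun g => ⟨fun hg => ?_, fun hg => ?_⟩⟩
  · have := congrArg (integralClosure R L).val ((huv g).1 hg)
    rwa [map_sum, map_one] at this
  · have := congrArg (integralClosure R L).val ((huv g).2 hg)
    rwa [map_sum, map_zero] at this

variable {G₁ G₂ : Subgroup Gal(L/K)} (hdis : ∀ g ∈ G₁, g ∈ G₂ → g = 1)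
  {n : ℕ} {u v : Fin n → L}
  (huv : ∀ g : Gal(L/K), (g ∈ G₂ → ∑ i, u i * g (v i) = 1) ∧ (g ∉ G₂ → ∑ i, u i * g (v i) = 0))

include hdis huv

/-- After exchanging the sums, `g b` has coefficient `∑ u_i * g (v_i)`, which vanishes for
nontrivial `g` in `G₁` because such a `g` is not in `G₂`. -/
theorem eq_sum_mul_groupTrace (b : L) : b = ∑ i, u i * groupTrace G₁ (v i * b) := by
  classical
  simp_rw [groupTrace_apply, map_mul, Finset.mul_sum]
  rw [Finset.sum_comm]
  simp_rw [← mul_assoc, ← Finset.sum_mul]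
  rw [Finset.sum_eq_single 1]
  · rw [OneMemClass.coe_one, (huv 1).1 G₂.one_mem, one_mul]
    rfl
  · intro g _ hg
    rw [(huv _).2 fun h => hg (Subtype.ext (hdis g g.2 h)), zero_mul]
  · simp

/-- The traces of the `v i` are fixed by the whole group and integral, so they lie in `R`. Were they
all divisible by a uniformizer `π`, the expansion of `1` in Galois coordinates would make `π⁻¹`
integral. Hence some trace is a unit, and rescaling gives trace one. -/
theorem exists_groupTrace_eq_one [IsDomain R] [IsDiscreteValuationRing R] [IsFractionRing R K]
    [IsGalois K L] (hG : ∀ g h : Gal(L/K), g * h = h * g)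
    (hprod : ∀ g : Gal(L/K), ∃ g₁ ∈ G₁, ∃ g₂ ∈ G₂, g = g₁ * g₂)
    (hu : ∀ i, IsIntegral R (u i)) (hv : ∀ i, IsIntegral R (v i))
    (hv' : ∀ i, ∀ g ∈ G₂, g (v i) = v i) :
    ∃ x : L, IsIntegral R x ∧ (∀ g ∈ G₂, g x = x) ∧ groupTrace G₁ x = 1 := by
  classical
  have h1 : ∀ i, ∃ r : R, algebraMap R L r = groupTrace G₁ (v i) := by
    intro i
    have hfix : ∀ g : Gal(L/K), g (groupTrace G₁ (v i)) = groupTrace G₁ (v i) := by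
      intro g
      obtain ⟨g₁, hg₁, g₂, hg₂, rfl⟩ := hprod g
      rw [AlgEquiv.mul_apply, apply_groupTrace_of_fixed hG G₁ (hv' i g₂ hg₂),
        apply_groupTrace G₁ _ hg₁]
    obtain ⟨k, hk⟩ := (IsGalois.mem_range_algebraMap_iff_fixed (F := K) _).2 hfix
    have hint : IsIntegral R (groupTrace G₁ (v i)) := by
      rw [groupTrace_apply]
      exact IsIntegral.sum _ fun g _ => (hv i).map (((g : Gal(L/K)) : L →ₐ[K] L).restrictScalars R)
    rw [← hk, isIntegral_algebraMap_iff (algebraMap K L).injective] at hint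
    obtain ⟨r, hr⟩ := IsIntegrallyClosed.isIntegral_iff.1 hint
    exact ⟨r, by rw [IsScalarTower.algebraMap_apply R K L, hr, hk]⟩
  choose r hr using h1
  have h2 : ∃ i, IsUnit (r i) := by
    by_contra! hcon
    obtain ⟨π, hπ⟩ := IsDiscreteValuationRing.exists_irreducible R
    have h3 : ∀ i, ∃ t, r i = π * t := by
      intro i
      have : r i ∈ IsLocalRing.maximalIdeal R := hcon i
      rw [hπ.maximalIdeal_eq, Ideal.mem_span_singleton] at this
      exact this
    choose t ht using h3
    have h4 := eq_sum_mul_groupTrace hdis huv (1 : L)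
    simp_rw [mul_one, ← hr, ht, map_mul, mul_left_comm _ (algebraMap R L π)] at h4
    rw [← Finset.mul_sum] at h4
    have h5 : IsIntegral R (∑ i, u i * algebraMap R L (t i)) :=
      IsIntegral.sum _ fun i _ => (hu i).mul isIntegral_algebraMap
    have hπ0 : algebraMap R K π ≠ 0 := by
      rw [Ne, IsFractionRing.to_map_eq_zero_iff]
      exact hπ.ne_zero
    have h6 : algebraMap K L (algebraMap R K π)⁻¹ = ∑ i, u i * algebraMap R L (t i) := by
      rw [map_inv₀, ← IsScalarTower.algebraMap_apply]
      exact inv_eq_of_mul_eq_one_right h4.symm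
    rw [← h6, isIntegral_algebraMap_iff (algebraMap K L).injective] at h5
    obtain ⟨w, hw⟩ := IsIntegrallyClosed.isIntegral_iff.1 h5
    refine hπ.not_isUnit (IsUnit.of_mul_eq_one w (IsFractionRing.injective R K ?_))
    rw [map_mul, hw, map_one, mul_inv_cancel₀ hπ0]
  obtain ⟨i, e, he⟩ := h2
  refine ⟨algebraMap R L ((e⁻¹ : Rˣ) : R) * v i, isIntegral_algebraMap.mul (hv i),
    fun g hg => ?_, ?_⟩
  · rw [map_mul, hv' i g hg, IsScalarTower.algebraMap_apply R K L, AlgEquiv.commutes]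
  · rw [IsScalarTower.algebraMap_apply R K L, ← Algebra.smul_def, map_smul, ← hr, ← he,
      Algebra.smul_def, ← IsScalarTower.algebraMap_apply, ← map_mul, Units.inv_mul, map_one]

end GaloisCoordinates

end HopfGaloisModule

/-! ### Generators attached to a `p`-group factor and to a prime-to-`p` factor. -/

namespace HopfGaloisModule

namespace GPSubgroup

variable {K L : Type*} [Field K] [Field L] [Algebra K L] (P : GPSubgroup K L)

section

variable {Γ : Type*} [CommGroup Γ] [Fintype Γ] {i : Γ →* P.N} {R : Type*} [CommRing R] [Algebra R L]

theorem incl_mem_integralCoeff [Fintype P.N] {z : MonoidAlgebra L Γ}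
    (hz : z ∈ integralCoeff R L Γ) : P.incl i z ∈ integralCoeff R L P.N := by
  rw [eq_sum_single z, map_sum]
  refine sum_mem fun γ _ => ?_
  rw [incl_single]
  exact single_mem_integralCoeff _ ((mem_integralCoeff z).1 hz γ)

theorem act_incl (z : MonoidAlgebra L Γ) (x : L) :
    P.act (P.incl i z) x = ∑ γ, z.coeff γ * ((i γ : Equiv.Perm Gal(L/K))⁻¹ 1) x := by
  conv_lhs => rw [eq_sum_single z, map_sum, map_sum, LinearMap.sum_apply]
  refine Finset.sum_congr rfl fun γ _ => ?_
  rw [incl_single, act_single]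

variable {G₁ G₂ : Subgroup Gal(L/K)} (hi : P.IsFactor i G₁ G₂)

include hi in
omit [Fintype Γ] in
theorem IsFactor.inv_apply_one_mem (γ : Γ) : ((i γ : Equiv.Perm Gal(L/K))⁻¹ 1) ∈ G₁ := by
  have := hi.apply_one_mem γ⁻¹
  rwa [map_inv] at this

-- The image of `i` acts through automorphisms in `G₁`, which fix `y`. This lets each factor act on
-- its own part of a product.
include hi in
theorem act_incl_mul_of_fixed (z : MonoidAlgebra L Γ) (x : L) {y : L} (hy : ∀ g ∈ G₁, g y = y) :
    P.act (P.incl i z) (x * y) = P.act (P.incl i z) x * y := by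
  rw [act_incl, act_incl, Finset.sum_mul]
  refine Finset.sum_congr rfl fun γ _ => ?_
  rw [map_mul, hy _ (IsFactor.inv_apply_one_mem P hi γ), mul_assoc]

include hi in
/-- For a `p`-group `Γ`, elements of trace one have invertible resolvent. -/
theorem exists_mul_resolvent_eq_one [FiniteDimensional K L] [Algebra R K] [IsScalarTower R K L]
    [IsLocalRing R] (p : ℕ) [Fact p.Prime] (hp : (p : R) ∈ IsLocalRing.maximalIdeal R)
    (hΓ : IsPGroup p Γ) {x : L} (hx : IsIntegral R x) (htr : groupTrace G₁ x = 1) :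
    ∃ W ∈ integralCoeff R L Γ, W * P.resolvent i x = 1 := by
  classical
  have hint : ∀ γ, IsIntegral R ((i γ : Equiv.Perm Gal(L/K)) 1 x) := fun γ =>
    hx.map ((((i γ : Equiv.Perm Gal(L/K)) 1 : Gal(L/K)) : L →ₐ[K] L).restrictScalars R)
  -- Evaluation at `1` is a bijection from `Γ` to `G₁`, so the augmentation of the resolvent is the
  -- `G₁`-trace of `x`.
  have hsum : ∑ γ, (i γ : Equiv.Perm Gal(L/K)) 1 x = 1 := by
    rw [← htr, groupTrace_apply]
    refine Fintype.sum_bijective (fun γ => (⟨_, hi.apply_one_mem γ⟩ : G₁)) ⟨fun γ δ h => ?_,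
      fun g => ?_⟩ _ _ fun γ => rfl
    · exact hi.injective (P.eq_of_apply_one_eq (congrArg Subtype.val h))
    · obtain ⟨γ, hγ⟩ := hi.exists_apply_one g g.2
      exact ⟨γ, Subtype.ext hγ⟩
  have hu := MonoidAlgebra.isUnit_of_isUnit_augmentation (S := integralClosure R L) (Γ := Γ) p (by
    intro m hm
    have := Ideal.isMaximal_comap_of_isIntegral_of_isMaximal (R := R) m
    have h2 := IsLocalRing.eq_maximalIdeal this
    have h3 := h2 ▸ hp
    rw [Ideal.mem_comap, map_natCast] at h3
    exact h3) hΓ (fun γ => ⟨_, hint γ⟩) (by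
      have : ∑ γ, (⟨_, hint γ⟩ : integralClosure R L) = 1 := by
        apply Subtype.ext
        exact (map_sum (integralClosure R L).val _ _).trans hsum
      rw [this]
      exact isUnit_one)
  obtain ⟨w, hw⟩ := hu.exists_left_inv
  refine ⟨_, ⟨w, rfl⟩, ?_⟩
  have h4 := congrArg (MonoidAlgebra.mapAlgHom Γ (integralClosure R L).val) hw
  rw [map_mul, map_one, map_sum] at h4
  have h5 : P.resolvent i x = ∑ γ, MonoidAlgebra.mapAlgHom Γ (integralClosure R L).val
      (MonoidAlgebra.single γ ⟨_, hint γ⟩) := by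
    rw [resolvent]
    refine Finset.sum_congr rfl fun γ _ => ?_
    simp
  rw [h5]
  exact h4

include hi in
/-- Some element of the field fixed by `G₂` has invertible resolvent. -/
theorem exists_isUnit_resolvent [FiniteDimensional K L] [Infinite K]
    (hdis : ∀ g ∈ G₁, g ∈ G₂ → g = 1) :
    ∃ y : L, (∀ g ∈ G₂, g y = y) ∧ IsUnit (P.resolvent i y) := by
  classical
  have hart : IsArtinianRing (MonoidAlgebra L Γ) := IsArtinianRing.of_finite L _
  let f : L →ₗ[K] MonoidAlgebra L Γ :=
    ∑ γ, ((MonoidAlgebra.coeffLinearEquiv L).symm.toLinearMap.restrictScalars K) ∘ₗ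
      (Finsupp.lsingle γ) ∘ₗ
        (((i γ : Equiv.Perm Gal(L/K)) 1 : Gal(L/K)) : L →ₐ[K] L).toLinearMap
  have hf : ∀ y, f y = P.resolvent i y := by
    intro y
    simp only [f, resolvent, LinearMap.sum_apply]
    rfl
  -- The resolvent of a `G₂`-trace is a unit unless the element lies in one of these subspaces.
  -- There are finitely many of them, so over an infinite field it suffices that each is proper.
  let V : MaximalSpectrum (MonoidAlgebra L Γ) → Subspace K L := fun m =>
    LinearMap.ker ((Ideal.Quotient.mkₐ K m.asIdeal).toLinearMap ∘ₗ f ∘ₗ groupTrace G₂)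
  have hV : ∀ m y, y ∈ V m ↔ P.resolvent i (groupTrace G₂ y) ∈ m.asIdeal := by
    intro m y
    rw [← hf, ← Ideal.Quotient.eq_zero_iff_mem]
    rfl
  have hVtop : ∀ m, V m ≠ ⊤ := by
    intro m hm
    let := Ideal.Quotient.field m.asIdeal
    let q : MonoidAlgebra L Γ →+* MonoidAlgebra L Γ ⧸ m.asIdeal := Ideal.Quotient.mk m.asIdeal
    -- The automorphisms `γ 1 * g` with `g` in `G₂` are distinct because `G₁` and `G₂` meet
    -- trivially. If `V m` were everything, Dedekind independence over the residue field at `m`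
    -- would make the class of `1` vanish.
    let Φ : Γ × G₂ → (L →* MonoidAlgebra L Γ ⧸ m.asIdeal) := fun t =>
      ((q.comp (algebraMap L (MonoidAlgebra L Γ))).comp
        ((((i t.1 : Equiv.Perm Gal(L/K)) 1 * t.2 : Gal(L/K)) : L →ₐ[K] L) : L →+* L)).toMonoidHom
    have hΦ : ∀ t y, Φ t y = q (algebraMap L _ ((i t.1 : Equiv.Perm Gal(L/K)) 1 (t.2.1 y))) :=
      fun t y => rfl
    have hΦi : Function.Injective Φ := by
      rintro ⟨γ, g⟩ ⟨δ, h⟩ heq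
      have h1 : (i γ : Equiv.Perm Gal(L/K)) 1 * g.1 = (i δ : Equiv.Perm Gal(L/K)) 1 * h.1 := by
        ext y
        have h2 := DFunLike.congr_fun heq y
        rw [hΦ, hΦ] at h2
        exact (algebraMap L (MonoidAlgebra L Γ ⧸ m.asIdeal)).injective h2
      have h3 : ((i δ : Equiv.Perm Gal(L/K)) 1)⁻¹ * (i γ : Equiv.Perm Gal(L/K)) 1 =
          h.1 * g.1⁻¹ := by
        rw [eq_mul_inv_iff_mul_eq, mul_assoc, h1, inv_mul_cancel_left]
      have h4 := hdis _ (G₁.mul_mem (G₁.inv_mem (hi.apply_one_mem δ)) (hi.apply_one_mem γ))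
        (h3 ▸ G₂.mul_mem h.2 (G₂.inv_mem g.2))
      have h5 : δ = γ := hi.injective (P.eq_of_apply_one_eq (inv_mul_eq_one.1 h4))
      rw [h4] at h3
      have h6 : g = h := Subtype.ext (mul_inv_eq_one.1 h3.symm).symm
      rw [h5, h6]
    have hli := (linearIndependent_monoidHom L (MonoidAlgebra L Γ ⧸ m.asIdeal)).comp Φ hΦi
    rw [Fintype.linearIndependent_iff] at hli
    have h7 := hli (fun t => q (MonoidAlgebra.single t.1 1)) (by
      ext y
      have h8 : y ∈ V m := hm ▸ Submodule.mem_top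
      rw [hV, ← Ideal.Quotient.eq_zero_iff_mem] at h8
      have h9 : q (P.resolvent i (groupTrace G₂ y)) = 0 := h8
      rw [resolvent, groupTrace_apply, map_sum] at h9
      rw [Finset.sum_apply, Pi.zero_apply, ← h9, Fintype.sum_prod_type]
      refine Finset.sum_congr rfl fun γ _ => ?_
      rw [map_sum]
      have h10 : ∀ c : L, (MonoidAlgebra.single γ c : MonoidAlgebra L Γ) =
          MonoidAlgebra.single γ 1 * algebraMap L _ c := by
        intro c; simp
      rw [h10, map_mul, map_sum, map_sum, Finset.mul_sum]
      refine Finset.sum_congr rfl fun g _ => ?_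
      rw [Pi.smul_apply, Function.comp_apply, hΦ]
      rfl) (1, 1)
    have h11 : q (1 : MonoidAlgebra L Γ) = 0 := h7
    rw [map_one] at h11
    exact one_ne_zero h11
  have hcov : ⋃ m, (V m : Set L) ≠ Set.univ := fun h => by
    obtain ⟨m, hm⟩ := Subspace.exists_eq_top_of_iUnion_eq_univ h
    exact hVtop m hm
  obtain ⟨y, hy⟩ := (Set.ne_univ_iff_exists_notMem _).1 hcov
  refine ⟨groupTrace G₂ y, fun g hg => apply_groupTrace G₂ y hg, ?_⟩
  by_contra hcon
  obtain ⟨m, hm, hmem⟩ := exists_max_ideal_of_mem_nonunits hcon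
  exact hy (Set.mem_iUnion.2 ⟨⟨m, hm⟩, (hV ⟨m, hm⟩ y).2 hmem⟩)

include hi in
/-- If the order of `Γ` is prime to the residue characteristic of `R`, then lattices are cyclic
over the order attached to `Γ`. -/
theorem exists_generator_of_coprime [FiniteDimensional K L] [CharZero K]
    (hG : ∀ g h : Gal(L/K), g * h = h * g) (hdis : ∀ g ∈ G₁, g ∈ G₂ → g = 1)
    [Algebra R K] [IsScalarTower R K L] [IsDomain R] [IsDiscreteValuationRing R]
    [IsFractionRing R K] (hcard : IsUnit (Fintype.card Γ : R)) (M : Submodule R L) (hfg : M.FG)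
    (hMS : ∀ a, IsIntegral R a → ∀ x ∈ M, a * x ∈ M) (hMG : ∀ g : Gal(L/K), ∀ x ∈ M, g x ∈ M) :
    ∃ x ∈ M, ∀ b ∈ M, (∀ g ∈ G₂, g b = b) → ∃ z ∈ integralCoeff R L Γ,
      P.incl i z ∈ P.fixedAlgebra ∧ P.act (P.incl i z) x = b := by
  have : CharZero L := charZero_of_injective_algebraMap (algebraMap K L).injective
  obtain ⟨y, hy, hyu⟩ := P.exists_isUnit_resolvent hi hdis
  obtain ⟨W, hW⟩ := hyu.exists_left_inv
  -- The part of the fixed ring supported on `Γ`; it is reduced because it embeds in a commutative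
  -- group algebra that is semisimple by Maschke's theorem.
  let H : Subalgebra K (MonoidAlgebra L Γ) :=
    P.fixedAlgebra.comap ((P.incl i).restrictScalars K)
  have hH : ∀ z, z ∈ H ↔ P.incl i z ∈ P.fixedAlgebra := fun z => Iff.rfl
  have hfin : Module.Finite K (MonoidAlgebra L Γ) := Module.Finite.trans L _
  have hfinH : Module.Finite K H := Module.Finite.of_injective H.val.toLinearMap
    Subtype.val_injective
  have hcard0 : NeZero (Nat.card Γ : L) := ⟨by
    rw [Nat.card_eq_fintype_card]; exact Nat.cast_ne_zero.2 Fintype.card_ne_zero⟩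
  have hss : IsSemisimpleRing (MonoidAlgebra L Γ) := inferInstance
  have hred : IsReduced (MonoidAlgebra L Γ) := inferInstance
  have hredH : IsReduced H := isReduced_of_injective H.val Subtype.val_injective
  -- Evaluation at `y` is injective and reaches every element fixed by `G₂`, so the part of `M`
  -- fixed by `G₂` can be studied inside `H`.
  let ev : H →ₗ[R] L :=
    { toFun := fun z => P.act (P.incl i z) y
      map_add' := fun a b => by simp
      map_smul' := fun r a => by
        have : ((r • a : H) : MonoidAlgebra L Γ) =
            algebraMap R L r • (a : MonoidAlgebra L Γ) := by
          rw [algebraMap_smul]; rfl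
        rw [this, map_smul, map_smul, LinearMap.smul_apply, RingHom.id_apply, algebraMap_smul] }
  have hev : ∀ z : H, ev z = P.act (P.incl i z) y := fun z => rfl
  have hevi : Function.Injective ev := by
    rw [injective_iff_map_eq_zero]
    intro z hz
    exact Subtype.ext (P.eq_zero_of_act_incl_eq_zero hi hyu z.2 hz)
  have hevmul : ∀ a b : H, ev (a * b) = P.act (P.incl i a) (ev b) := by
    intro a b
    rw [hev, MulMemClass.coe_mul, map_mul, P.act_mul _ (P.incl i b) b.2]
    rfl
  -- The factor `Fintype.card Γ` in the trace argument is a unit of `R`, so integral elements have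
  -- integral coefficients. Hence they stabilize `M`, and its preimage under `ev` is a lattice over
  -- the maximal order.
  have hint : ∀ a : H, IsIntegral R a → (a : MonoidAlgebra L Γ) ∈ integralCoeff R L Γ := by
    intro a ha
    rw [mem_integralCoeff]
    intro γ
    have h1 : IsIntegral R (a : MonoidAlgebra L Γ) := ha.map (H.val.restrictScalars R)
    have h2 := MonoidAlgebra.isIntegral_card_mul_coeff _ h1 γ
    obtain ⟨e, he⟩ := hcard
    have h3 : algebraMap R L ((e⁻¹ : Rˣ) : R) * ((Fintype.card Γ : L) *
        (a : MonoidAlgebra L Γ).coeff γ) = (a : MonoidAlgebra L Γ).coeff γ := by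
      rw [← map_natCast (algebraMap R L), ← he, ← mul_assoc, ← map_mul, Units.inv_mul, map_one,
        one_mul]
    rw [← h3]
    exact isIntegral_algebraMap.mul h2
  have hstab : ∀ z ∈ integralCoeff R L Γ, ∀ x ∈ M, P.act (P.incl i z) x ∈ M := by
    intro z hz x hx
    rw [act_incl]
    exact M.sum_mem fun γ _ => hMS _ ((mem_integralCoeff z).1 hz γ) _ (hMG _ _ hx)
  have hMn : IsNoetherian R M := isNoetherian_of_fg_of_noetherian M hfg
  have hJfg : (M.comap ev).FG := by
    let f : M.comap ev →ₗ[R] M := ev.restrict fun z hz => hz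
    have hf : Function.Injective f := fun a b h =>
      Subtype.ext (hevi (congrArg Subtype.val h))
    have := isNoetherian_of_injective f hf
    exact Module.Finite.iff_fg.1 (Module.IsNoetherian.finite R _)
  obtain ⟨j, hj, hj'⟩ := exists_generator_of_isReduced (R := R) (K := K) H (M.comap ev) hJfg (by
    intro a ha z hz
    rw [Submodule.mem_comap, hevmul]
    exact hstab _ (hint a ha) _ hz)
  refine ⟨ev j, hj, fun b hb hb' => ?_⟩
  have h1 := P.incl_resolvent_mul_mem_fixedAlgebra hi hG hy hb' hW
  obtain ⟨a, ha, haj⟩ := hj' (⟨_, h1⟩ : H) (by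
    rw [Submodule.mem_comap, hev, P.act_incl_resolvent_mul hW]
    exact hb)
  refine ⟨a, hint a ha, a.2, ?_⟩
  rw [← hevmul, ← haj, hev, P.act_incl_resolvent_mul hW]

end

end GPSubgroup

end HopfGaloisModule

/-! ### Combining the two factors under the tameness condition. -/

namespace HopfGaloisModule

/-- The elements killed by `k` in a commutative group. -/
def powKer {Γ : Type*} [Group Γ] (h : ∀ a b : Γ, a * b = b * a) (k : ℕ) : Subgroup Γ where
  carrier := {γ | γ ^ k = 1}
  one_mem' := one_pow k
  mul_mem' {a b} ha hb := by
    change (a * b) ^ k = 1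
    rw [Commute.mul_pow (h a b), show a ^ k = 1 from ha, show b ^ k = 1 from hb, one_mul]
  inv_mem' {a} ha := by
    change a⁻¹ ^ k = 1
    rw [inv_pow, show a ^ k = 1 from ha, inv_one]

theorem exists_mul_of_coprime {Γ : Type*} [Group Γ] (h : ∀ a b : Γ, a * b = b * a) {k l : ℕ}
    (hkl : k.Coprime l) {γ : Γ} (hγ : γ ^ (k * l) = 1) :
    ∃ μ ∈ powKer h k, ∃ μ' ∈ powKer h l, γ = μ * μ' := by
  have hbez := Nat.gcd_eq_gcd_ab k l
  rw [hkl.gcd_eq_one] at hbez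
  have hγ' : γ ^ ((k : ℤ) * l) = 1 := by exact_mod_cast hγ
  refine ⟨γ ^ ((l : ℤ) * Nat.gcdB k l), ?_, γ ^ ((k : ℤ) * Nat.gcdA k l), ?_, ?_⟩
  · change (γ ^ ((l : ℤ) * Nat.gcdB k l)) ^ k = 1
    rw [← zpow_natCast, ← zpow_mul, mul_right_comm, mul_comm (l : ℤ), zpow_mul, hγ', one_zpow]
  · change (γ ^ ((k : ℤ) * Nat.gcdA k l)) ^ l = 1
    rw [← zpow_natCast, ← zpow_mul, mul_right_comm, zpow_mul, hγ', one_zpow]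
  · rw [← zpow_add, add_comm, ← hbez, Nat.cast_one, zpow_one]

theorem isUnit_natCast_of_coprime {R : Type*} [CommRing R] [IsLocalRing R] {p c : ℕ}
    (hp : (p : R) ∈ IsLocalRing.maximalIdeal R) (hc : c.Coprime p) : IsUnit (c : R) := by
  by_contra hcon
  have h1 : (c : R) ∈ IsLocalRing.maximalIdeal R := hcon
  obtain ⟨a, b, hab⟩ := (Nat.isCoprime_iff_coprime.2 hc).map (Int.castRingHom R)
  have h2 : (1 : R) ∈ IsLocalRing.maximalIdeal R := by
    rw [← hab]
    refine Ideal.add_mem _ (Ideal.mul_mem_left _ _ ?_) (Ideal.mul_mem_left _ _ ?_) <;> simpa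
  exact (Ideal.ne_top_iff_one _).1 (IsLocalRing.maximalIdeal.isMaximal R).ne_top h2

namespace GPSubgroup

variable {K L : Type*} [Field K] [Field L] [Algebra K L] (P : GPSubgroup K L)
  {R : Type*} [CommRing R] [Algebra R L]

/-- Given a factorization of `N` into a `p`-group and a group of order prime to `p` such that all
inertia groups are in the second factor, stable lattices in `L` are cyclic. -/
theorem exists_generator_of_isFactor [FiniteDimensional K L] [IsGalois K L] [CharZero K]
    [Algebra R K] [IsScalarTower R K L] [IsDomain R] [IsDiscreteValuationRing R]
    [IsFractionRing R K] [Fintype P.N]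
    (hG : ∀ g h : Gal(L/K), g * h = h * g) {Γ₁ Γ₂ : Type*} [CommGroup Γ₁] [CommGroup Γ₂]
    [Fintype Γ₁] [Fintype Γ₂] {i₁ : Γ₁ →* P.N} {i₂ : Γ₂ →* P.N} {G₁ G₂ : Subgroup Gal(L/K)}
    (h₁ : P.IsFactor i₁ G₁ G₂) (h₂ : P.IsFactor i₂ G₂ G₁) (hdis : ∀ g ∈ G₁, g ∈ G₂ → g = 1)
    (p : ℕ) [Fact p.Prime] (hp : (p : R) ∈ IsLocalRing.maximalIdeal R) (hΓ₁ : IsPGroup p Γ₁)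
    (hΓ₂ : (Fintype.card Γ₂).Coprime p)
    (hin : ∀ Q : Ideal (integralClosure R L), Q.IsMaximal → ∀ g : Gal(L/K),
      (∀ s : integralClosure R L, ∃ t ∈ Q, (t : L) = g s - s) → g ∈ G₂)
    (M : Submodule R L) (hfg : M.FG)
    (hMS : ∀ a, IsIntegral R a → ∀ x ∈ M, a * x ∈ M) (hMG : ∀ g : Gal(L/K), ∀ x ∈ M, g x ∈ M) :
    ∃ x ∈ M, ∀ b ∈ M, ∃ z ∈ P.fixedAlgebra, z ∈ integralCoeff R L P.N ∧ P.act z x = b := by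
  classical
  have hnormal : G₂.Normal := ⟨fun n hn g => by rwa [hG g n, mul_inv_cancel_right]⟩
  obtain ⟨n, u, v, hu, hv, hu', hv', huv⟩ := exists_galois_coordinates_of_field G₂ hin
  obtain ⟨x₁, hx₁, hx₁', htr⟩ := exists_groupTrace_eq_one hdis huv hG h₁.exists_mul hu hv hv'
  obtain ⟨W, hWint, hW⟩ := P.exists_mul_resolvent_eq_one h₁ p hp hΓ₁ hx₁ htr
  obtain ⟨x₂, hx₂, hx₂'⟩ := P.exists_generator_of_coprime h₂ hG (fun g hg hg' => hdis g hg' hg)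
    (isUnit_natCast_of_coprime hp hΓ₂) M hfg hMS hMG
  -- In `b = ∑ u_i * Tr(v_i * b)`, the first factors come from `x₁` and the traces, which are fixed
  -- by `G₁`, come from `x₂`.
  refine ⟨x₁ * x₂, hMS _ hx₁ _ hx₂, fun b hb => ?_⟩
  have hbM : ∀ i, groupTrace G₁ (v i * b) ∈ M := fun i => by
    rw [groupTrace_apply]
    exact M.sum_mem fun g _ => hMG _ _ (hMS _ (hv i) _ hb)
  choose z hz hzfix hzact using fun i => hx₂' _ (hbM i) fun g hg => apply_groupTrace G₁ _ hg
  have hw : ∀ i, P.incl i₁ (P.resolvent i₁ (u i) * W) ∈ P.fixedAlgebra := fun i =>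
    P.incl_resolvent_mul_mem_fixedAlgebra h₁ hG hx₁' (hu' i) hW
  have hwint : ∀ i, P.resolvent i₁ (u i) ∈ integralCoeff R L Γ₁ := fun i =>
    sum_mem fun γ _ => single_mem_integralCoeff _
      ((hu i).map ((((i₁ γ : Equiv.Perm Gal(L/K)) 1 : Gal(L/K)) : L →ₐ[K] L).restrictScalars R))
  refine ⟨∑ i, P.incl i₁ (P.resolvent i₁ (u i) * W) * P.incl i₂ (z i),
    sum_mem fun i _ => mul_mem (hw i) (hzfix i),
    sum_mem fun i _ => mul_mem (P.incl_mem_integralCoeff (mul_mem (hwint i) hWint))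
      (P.incl_mem_integralCoeff (hz i)), ?_⟩
  rw [map_sum, LinearMap.sum_apply]
  conv_rhs => rw [eq_sum_mul_groupTrace hdis huv b]
  refine Finset.sum_congr rfl fun i _ => ?_
  -- The second factor acts first and passes by `x₁`, which is fixed by `G₂`; the first factor then
  -- passes by the trace, which is fixed by `G₁`.
  rw [P.act_mul _ _ (hzfix i), Module.End.mul_apply, mul_comm x₁,
    P.act_incl_mul_of_fixed h₂ _ _ hx₁', hzact, mul_comm _ x₁,
    P.act_incl_mul_of_fixed h₁ _ _ fun g hg => apply_groupTrace G₁ _ hg,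
    P.act_incl_resolvent_mul hW]

/-- If all inertia groups have order prime to the residue characteristic, then stable lattices in
`L` are cyclic. -/
theorem exists_generator_of_tame [FiniteDimensional K L] [IsGalois K L] [CharZero K]
    [Algebra R K] [IsScalarTower R K L] [IsDomain R] [IsDiscreteValuationRing R]
    [IsFractionRing R K] [Fintype P.N]
    (hG : ∀ g h : Gal(L/K), g * h = h * g) (hN : ∀ η μ : P.N, η * μ = μ * η)
    (p : ℕ) [Fact p.Prime] (hp : (p : R) ∈ IsLocalRing.maximalIdeal R)
    (hin : ∀ Q : Ideal (integralClosure R L), Q.IsMaximal → ∀ g : Gal(L/K),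
      (∀ s : integralClosure R L, ∃ t ∈ Q, (t : L) = g s - s) → ¬ p ∣ orderOf g)
    (M : Submodule R L) (hfg : M.FG)
    (hMS : ∀ a, IsIntegral R a → ∀ x ∈ M, a * x ∈ M) (hMG : ∀ g : Gal(L/K), ∀ x ∈ M, g x ∈ M) :
    ∃ x ∈ M, ∀ b ∈ M, ∃ z ∈ P.fixedAlgebra, z ∈ integralCoeff R L P.N ∧ P.act z x = b := by
  classical
  have hpp : p.Prime := Fact.out
  obtain ⟨a, m, hm, hcard⟩ := Nat.exists_eq_pow_mul_and_not_dvd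
    (Nat.card_pos (α := P.N)).ne' p hpp.ne_one
  have hcop : (p ^ a).Coprime m := Nat.Coprime.pow_left a ((hpp.coprime_iff_not_dvd).2 hm)
  set M₁ := powKer hN (p ^ a) with hM₁
  set M₂ := powKer hN m with hM₂
  have hstab : ∀ k g, ∀ η ∈ powKer hN k, P.conj g η ∈ powKer hN k := by
    intro k g η hη
    change P.conj g η ^ k = 1
    rw [← map_pow, show η ^ k = 1 from hη, map_one]
  have hdis : ∀ η ∈ M₁, η ∈ M₂ → η = 1 := by
    intro η h1 h2
    rw [← orderOf_eq_one_iff, ← Nat.dvd_one, ← hcop.gcd_eq_one]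
    exact Nat.dvd_gcd (orderOf_dvd_of_pow_eq_one h1) (orderOf_dvd_of_pow_eq_one h2)
  have hprod : ∀ η, ∃ μ ∈ M₁, ∃ μ' ∈ M₂, η = μ * μ' := fun η =>
    exists_mul_of_coprime hN hcop (by rw [← hcard]; exact pow_card_eq_one')
  have hprod' : ∀ η, ∃ μ ∈ M₂, ∃ μ' ∈ M₁, η = μ * μ' := fun η => by
    obtain ⟨μ, hμ, μ', hμ', rfl⟩ := hprod η
    exact ⟨μ', hμ', μ, hμ, hN _ _⟩
  have h₁ := P.isFactor_of_isComplement hG hN (hstab _) (hstab _) hdis hprod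
  have h₂ := P.isFactor_of_isComplement hG hN (hstab _) (hstab _)
    (fun η h2 h1 => hdis η h1 h2) hprod'
  have hdisG : ∀ g ∈ P.orbit M₁ (hstab _), g ∈ P.orbit M₂ (hstab _) → g = 1 := fun g hg hg' =>
    P.eq_one_of_mem_orbit (hstab _) (hstab _) hdis hg hg'
  have hΓ₁ : IsPGroup p M₁ := fun γ => ⟨a, Subtype.ext γ.2⟩
  let c₁ : CommGroup M₁ := { (inferInstance : Group M₁) with
    mul_comm := fun x y => Subtype.ext (hN _ _) }
  let c₂ : CommGroup M₂ := { (inferInstance : Group M₂) with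
    mul_comm := fun x y => Subtype.ext (hN _ _) }
  have hΓ₂ : (Fintype.card M₂).Coprime p := by
    rw [Nat.coprime_comm, hpp.coprime_iff_not_dvd]
    intro hdvd
    obtain ⟨γ, hγ⟩ := exists_prime_orderOf_dvd_card p hdvd
    exact hm (hγ ▸ orderOf_dvd_of_pow_eq_one (Subtype.ext γ.2))
  refine P.exists_generator_of_isFactor hG h₁ h₂ hdisG p hp hΓ₁ hΓ₂ ?_ M hfg hMS hMG
  intro Q hQ g hg
  -- The `G₁`-component `g₁` has `p`-power order, and its order also divides that of the inertial
  -- element, which is prime to `p`; hence `g₁ = 1`.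
  have hord := hin Q hQ g hg
  obtain ⟨g₁, hg₁, g₂, hg₂, rfl⟩ := h₁.exists_mul g
  have hpow : g₁ ^ orderOf (g₁ * g₂) = 1 := by
    refine hdisG _ (pow_mem hg₁ _) ?_
    have h3 := pow_orderOf_eq_one (g₁ * g₂)
    rw [Commute.mul_pow (hG g₁ g₂)] at h3
    rw [eq_inv_of_mul_eq_one_left h3]
    exact inv_mem (pow_mem hg₂ _)
  have hpow' : ∃ b, g₁ ^ p ^ b = 1 := by
    obtain ⟨b, hb⟩ := IsPGroup.iff_card.1 hΓ₁
    have hc : Nat.card (P.orbit M₁ (hstab _)) = Nat.card M₁ := by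
      refine (Nat.card_eq_of_bijective (fun γ : M₁ =>
        (⟨_, h₁.apply_one_mem γ⟩ : P.orbit M₁ (hstab _))) ⟨fun γ δ h => ?_, fun g => ?_⟩).symm
      · exact h₁.injective (P.eq_of_apply_one_eq (congrArg Subtype.val h))
      · obtain ⟨γ, hγ⟩ := h₁.exists_apply_one g g.2
        exact ⟨γ, Subtype.ext hγ⟩
    refine ⟨b, ?_⟩
    rw [← hb, ← hc]
    exact congrArg Subtype.val (pow_card_eq_one' (x := (⟨g₁, hg₁⟩ : P.orbit M₁ (hstab _))))
  obtain ⟨b, hb⟩ := hpow'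
  have h4 : (orderOf (g₁ * g₂)).Coprime (p ^ b) :=
    (Nat.Coprime.pow_left b ((hpp.coprime_iff_not_dvd).2 hord)).symm
  have h5 : g₁ = 1 := by
    rw [← orderOf_eq_one_iff, ← Nat.dvd_one, ← h4.gcd_eq_one]
    exact Nat.dvd_gcd (orderOf_dvd_of_pow_eq_one hpow) (orderOf_dvd_of_pow_eq_one hb)
  rw [h5, one_mul]
  exact hg₂

end GPSubgroup

end HopfGaloisModule

/-! ### Commutativity of `N` and faithfulness of the action. -/

namespace HopfGaloisModule

namespace GPSubgroup

section Commutative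

variable {K L : Type*} [Field K] [Field L] [Algebra K L] (P : GPSubgroup K L)

theorem galAct_mul_apply (g h : Gal(L/K)) (z : P.GroupAlgebra) :
    P.galAct (g * h) z = P.galAct g (P.galAct h z) := by
  induction z using MonoidAlgebra.induction_linear with
  | zero => simp
  | add a b ha hb => simp only [map_add, ha, hb]
  | single η c =>
    rw [galAct_single, galAct_single, galAct_single]
    congr 1

/-- The elements of `N` are `L`-linear combinations of elements of the fixed ring. -/
theorem single_one_mem_span_fixedAlgebra [FiniteDimensional K L] (η : P.N) :
    MonoidAlgebra.single η 1 ∈ Submodule.span L (P.fixedAlgebra : Set P.GroupAlgebra) := by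
  classical
  -- Taking `R = K` and the trivial subgroup gives Galois coordinates for `L` over `K`: all elements
  -- are integral over the field `K`, and nonzero ones are units, so inertia is trivial.
  obtain ⟨n, u, v, -, -, -, -, huv⟩ := exists_galois_coordinates_of_field (R := K)
    (⊥ : Subgroup Gal(L/K)) (by
      intro Q hQ g hg
      rw [Subgroup.mem_bot]
      ext s
      obtain ⟨t, ht, hts⟩ := hg ⟨s, Algebra.IsIntegral.isIntegral s⟩
      by_contra hne
      have ht0 : (t : L) ≠ 0 := by
        rw [hts]
        exact sub_ne_zero.2 hne
      refine hQ.ne_top ((Ideal.eq_top_iff_one _).2 ?_)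
      have h1 : (⟨(t : L)⁻¹, Algebra.IsIntegral.isIntegral _⟩ : integralClosure K L) * t = 1 :=
        Subtype.ext (inv_mul_cancel₀ ht0)
      rw [← h1]
      exact Q.mul_mem_left _ ht)
  have hfix : ∀ c, ∑ g, P.galAct g (MonoidAlgebra.single η c) ∈ P.fixedAlgebra := by
    intro c
    rw [P.mem_fixedAlgebra]
    intro h
    rw [map_sum]
    exact Fintype.sum_equiv (Equiv.mulLeft h) _ _ fun g => (P.galAct_mul_apply h g _).symm
  -- The Galois coordinates cancel every conjugate except the one with `g = 1`.
  have hsum : MonoidAlgebra.single η 1 =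
      ∑ i, u i • ∑ g, P.galAct g (MonoidAlgebra.single η (v i)) := by
    simp_rw [galAct_single, Finset.smul_sum, MonoidAlgebra.smul_single, smul_eq_mul]
    rw [Finset.sum_comm, Finset.sum_eq_single 1]
    · have h1 := (huv 1).1 (Subgroup.mem_bot.2 rfl)
      rw [← h1]
      have h2 : P.conj 1 η = η := by
        ext x : 2
        simp [conj_apply]
      rw [h2]
      exact map_sum (MonoidAlgebra.singleAddHom η) _ _
    · intro g _ hg
      have h1 := (huv g).2 fun h => hg (Subgroup.mem_bot.1 h)
      refine (map_sum (MonoidAlgebra.singleAddHom (P.conj g η)) _ _).symm.trans ?_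
      rw [h1, map_zero]
    · simp
  rw [hsum]
  exact Submodule.sum_mem _ fun i _ => Submodule.smul_mem _ _ (Submodule.subset_span (hfix _))

/-- If the fixed ring is commutative, then so is `N`. -/
theorem mul_comm_of_fixedAlgebra [FiniteDimensional K L]
    (hcomm : ∀ z ∈ P.fixedAlgebra, ∀ w ∈ P.fixedAlgebra, z * w = w * z) (η μ : P.N) :
    η * μ = μ * η := by
  have h1 : ∀ z ∈ Submodule.span L (P.fixedAlgebra : Set P.GroupAlgebra),
      ∀ w ∈ Submodule.span L (P.fixedAlgebra : Set P.GroupAlgebra), z * w = w * z := by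
    intro z hz w hw
    induction hz using Submodule.span_induction with
    | zero => simp
    | add a b _ _ ha hb => rw [add_mul, mul_add, ha, hb]
    | smul c a _ ha => rw [smul_mul_assoc, mul_smul_comm, ha]
    | mem z hz =>
      induction hw using Submodule.span_induction with
      | zero => simp
      | add a b _ _ ha hb => rw [add_mul, mul_add, ha, hb]
      | smul c a _ ha => rw [smul_mul_assoc, mul_smul_comm, ha]
      | mem w hw => exact hcomm z hz w hw
  have h2 := h1 _ (P.single_one_mem_span_fixedAlgebra η) _ (P.single_one_mem_span_fixedAlgebra μ)
  rw [MonoidAlgebra.single_mul_single, MonoidAlgebra.single_mul_single, one_mul] at h2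
  exact MonoidAlgebra.single_left_injective one_ne_zero h2

/-- The action of `L[N]` on `L` is faithful. -/
theorem act_injective : Function.Injective P.act := by
  rw [injective_iff_map_eq_zero]
  intro z hz
  have hinj : Function.Injective fun η : P.N =>
      ((((η : Equiv.Perm Gal(L/K))⁻¹) 1 : Gal(L/K)) : L →ₐ[K] L) := by
    intro η μ h
    have h1 : ((η⁻¹ : P.N) : Equiv.Perm Gal(L/K)) 1 = ((μ⁻¹ : P.N) : Equiv.Perm Gal(L/K)) 1 :=
      AlgEquiv.ext fun x => DFunLike.congr_fun h x
    exact inv_injective (P.eq_of_apply_one_eq h1)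
  have hli := (linearIndependent_toLinearMap K L L).comp _ hinj
  rw [linearIndependent_iff] at hli
  have h3 := hli ((MonoidAlgebra.coeffLinearEquiv L) z) hz
  exact (MonoidAlgebra.coeffLinearEquiv L).map_eq_zero_iff.1 h3

end Commutative

end GPSubgroup

/-! ### Inertia and fractional ideals after localizing at a prime. -/

section Localization

variable {K L : Type*} [Field K] [NumberField K] [Field L] [NumberField L] [Algebra K L]
  (v : IsDedekindDomain.HeightOneSpectrum (𝓞 K))

theorem exists_prime_natCast_mem : ∃ p : ℕ, p.Prime ∧ (p : 𝓞 K) ∈ v.asIdeal := by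
  obtain ⟨p, hp⟩ := CharP.exists (𝓞 K ⧸ v.asIdeal)
  refine ⟨p, CharP.char_is_prime (𝓞 K ⧸ v.asIdeal) p, ?_⟩
  rw [← Ideal.Quotient.eq_zero_iff_mem, map_natCast]
  exact CharP.cast_eq_zero _ _

theorem isUnit_algebraMap_adicCompletionIntegers {s : 𝓞 K} (hs : s ∉ v.asIdeal) :
    IsUnit (algebraMap (𝓞 K) (v.adicCompletionIntegers K) s) := by
  rw [IsDedekindDomain.HeightOneSpectrum.adicCompletionIntegers.isUnit_iff_valued_eq_one]
  change Valued.v ((algebraMap (𝓞 K) K s : K) : v.adicCompletion K) = 1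
  rw [IsDedekindDomain.HeightOneSpectrum.valuedAdicCompletion_eq_valuation']
  exact v.valuation_eq_one_iff_notMem.2 hs

variable (R : Type*) [CommRing R] [Algebra (𝓞 K) R] [IsLocalization.AtPrime R v.asIdeal]
  [Algebra R L] [IsScalarTower (𝓞 K) R L]

-- The contraction of `Q` to `𝓞 L` is a prime above `v` containing `p`, and `g` lies in its inertia
-- group. The order of that group is the ramification index, which tameness makes prime to `p`.
include v in
theorem not_dvd_orderOf_of_isTame [IsGalois K L] (htame : IsTame K L) [IsLocalRing R]
    {p : ℕ} (hp : p.Prime) (hpv : (p : 𝓞 K) ∈ v.asIdeal) (Q : Ideal (integralClosure R L))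
    (hQ : Q.IsMaximal) (g : Gal(L/K))
    (hg : ∀ s : integralClosure R L, ∃ t ∈ Q, (t : L) = g s - s) : ¬ p ∣ orderOf g := by
  have hint : ∀ x : 𝓞 L, IsIntegral R (x : L) := fun x =>
    ((Algebra.IsIntegral.isIntegral (R := 𝓞 K) x).map (IsScalarTower.toAlgHom (𝓞 K) (𝓞 L) L)
      ).tower_top
  let f : 𝓞 L →+* integralClosure R L :=
    (algebraMap (𝓞 L) L).codRestrict (integralClosure R L) hint
  let q : Ideal (𝓞 L) := Q.comap f
  have hqp : q.IsPrime := hQ.isPrime.comap f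
  have hQR := Ideal.isMaximal_comap_of_isIntegral_of_isMaximal (R := R) Q
  have hmem : ∀ x : 𝓞 K, algebraMap (𝓞 K) (𝓞 L) x ∈ q ↔ x ∈ v.asIdeal := by
    intro x
    have h1 : f (algebraMap (𝓞 K) (𝓞 L) x) = algebraMap R _ (algebraMap (𝓞 K) R x) := by
      apply Subtype.ext
      change algebraMap (𝓞 L) L (algebraMap (𝓞 K) (𝓞 L) x) = algebraMap R L (algebraMap (𝓞 K) R x)
      rw [← IsScalarTower.algebraMap_apply, ← IsScalarTower.algebraMap_apply]
    rw [Ideal.mem_comap, h1, ← Ideal.mem_comap, IsLocalRing.eq_maximalIdeal hQR,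
      IsLocalization.AtPrime.to_map_mem_maximal_iff R v.asIdeal]
  have hover : q.LiesOver v.asIdeal := ⟨by
    ext x
    rw [Ideal.under_def, Ideal.mem_comap, hmem]⟩
  have hpq : (p : 𝓞 L) ∈ q := by
    rw [← map_natCast (algebraMap (𝓞 K) (𝓞 L)), hmem]
    exact hpv
  have hq0 : q ≠ ⊥ := by
    rintro h0
    rw [h0, Ideal.mem_bot, Nat.cast_eq_zero] at hpq
    exact hp.ne_zero hpq
  have hgq : g ∈ q.inertia Gal(L/K) := by
    intro x
    obtain ⟨t, ht, hts⟩ := hg (f x)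
    change f (g • x - x) ∈ Q
    have : f (g • x - x) = t := by
      apply Subtype.ext
      rw [hts]
      rfl
    rwa [this]
  have hcard := Ideal.card_inertia_eq_ramificationIdxIn (G := Gal(L/K)) v.asIdeal q
  rw [Ideal.ramificationIdxIn_eq_ramificationIdx v.asIdeal q Gal(L/K)] at hcard
  intro hdvd
  refine htame q hqp hq0 p hp hpq (hdvd.trans ?_)
  rw [← hcard]
  exact Subgroup.orderOf_dvd_natCard _ hgq

variable (B : FractionalIdeal (𝓞 L)⁰ L)

omit [NumberField K] [NumberField L] in
theorem mem_span_localization (x : L) : x ∈ Submodule.span R (B : Set L) ↔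
    ∃ s ∈ v.asIdeal.primeCompl, algebraMap (𝓞 K) L s * x ∈ B := by
  have hsmul : ∀ (s : 𝓞 K) (y : L), y ∈ B → algebraMap (𝓞 K) L s * y ∈ B := by
    intro s y hy
    have := (B : Submodule (𝓞 L) L).smul_mem (algebraMap (𝓞 K) (𝓞 L) s) hy
    rwa [Algebra.smul_def, ← IsScalarTower.algebraMap_apply] at this
  constructor
  · intro hx
    induction hx using Submodule.span_induction with
    | mem x hx => exact ⟨1, one_mem _, by rwa [map_one, one_mul]⟩
    | zero => exact ⟨1, one_mem _, by rw [mul_zero]; exact (B : Submodule (𝓞 L) L).zero_mem⟩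
    | add a b _ _ ha hb =>
      obtain ⟨s, hs, hs'⟩ := ha
      obtain ⟨t, ht, ht'⟩ := hb
      refine ⟨s * t, mul_mem hs ht, ?_⟩
      rw [map_mul, mul_add]
      refine (B : Submodule (𝓞 L) L).add_mem ?_ ?_
      · rw [mul_right_comm, mul_comm]; exact hsmul _ _ hs'
      · rw [mul_assoc]; exact hsmul _ _ ht'
    | smul r a _ ha =>
      obtain ⟨s, hs, hs'⟩ := ha
      obtain ⟨⟨c, t⟩, hct⟩ := IsLocalization.surj v.asIdeal.primeCompl r
      refine ⟨t * s, mul_mem t.2 hs, ?_⟩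
      have h1 : algebraMap (𝓞 K) L (t * s) * r • a =
          algebraMap (𝓞 K) L c * (algebraMap (𝓞 K) L s * a) := by
        have h2 : algebraMap (𝓞 K) L c = algebraMap R L r * algebraMap (𝓞 K) L t := by
          rw [IsScalarTower.algebraMap_apply (𝓞 K) R L, IsScalarTower.algebraMap_apply (𝓞 K) R L,
            ← map_mul, hct]
        rw [h2, Algebra.smul_def, map_mul]
        ring
      rw [h1]
      exact hsmul _ _ hs'
  · rintro ⟨s, hs, hx⟩
    obtain ⟨e, he⟩ := IsLocalization.map_units R (⟨s, hs⟩ : v.asIdeal.primeCompl)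
    have h1 := (Submodule.span R (B : Set L)).smul_mem ((e⁻¹ : Rˣ) : R)
      (Submodule.subset_span (show algebraMap (𝓞 K) L s * x ∈ (B : Set L) from hx))
    have h2 : ((e⁻¹ : Rˣ) : R) • (algebraMap (𝓞 K) L s * x) = x := by
      rw [IsScalarTower.algebraMap_apply (𝓞 K) R L, ← he, ← Algebra.smul_def, smul_smul,
        Units.inv_mul, one_smul]
    rwa [h2] at h1

-- A multiple `s • a` with `s` outside `v` is an algebraic integer, so it preserves `B`; the
-- denominators of `a` and `x` are then combined.
include v in
omit [NumberField K] [NumberField L] in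
theorem mul_mem_span_localization {a : L} (ha : IsIntegral R a) {x : L}
    (hx : x ∈ Submodule.span R (B : Set L)) : a * x ∈ Submodule.span R (B : Set L) := by
  obtain ⟨⟨s, hs⟩, hsa⟩ :=
    IsIntegral.exists_multiple_integral_of_isLocalization v.asIdeal.primeCompl a ha
  rw [mem_span_localization v] at hx ⊢
  obtain ⟨t, ht, hx⟩ := hx
  have h1 : IsIntegral ℤ (s • a : L) := isIntegral_trans (A := 𝓞 K) _ hsa
  refine ⟨s * t, mul_mem hs ht, ?_⟩
  have h2 := (B : Submodule (𝓞 L) L).smul_mem (⟨s • a, h1⟩ : 𝓞 L) hx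
  have h3 : algebraMap (𝓞 K) L (s * t) * (a * x) =
      (⟨s • a, h1⟩ : 𝓞 L) • (algebraMap (𝓞 K) L t * x) := by
    rw [Algebra.smul_def]
    change _ = (s • a) * _
    rw [Algebra.smul_def, map_mul]
    ring
  rw [h3]
  exact h2

variable (K) in
theorem exists_finset_span_eq : ∃ T : Finset L, (Submodule.span (𝓞 K) (T : Set L) : Set L) = B := by
  have h0 : IsNoetherian (𝓞 L) (B : Submodule (𝓞 L) L) := FractionalIdeal.isNoetherian B
  have h1 : Module.Finite (𝓞 L) (B : Submodule (𝓞 L) L) := Module.IsNoetherian.finite _ _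
  have h2 : Module.Finite (𝓞 K) (B : Submodule (𝓞 L) L) := Module.Finite.trans (𝓞 L) _
  have h3 : ((B : Submodule (𝓞 L) L).restrictScalars (𝓞 K)).FG := Module.Finite.iff_fg.1 h2
  obtain ⟨T, hT⟩ := h3
  exact ⟨T, by rw [hT]; rfl⟩

include K in
theorem span_localization_fg : (Submodule.span R (B : Set L)).FG := by
  obtain ⟨T, hT⟩ := exists_finset_span_eq K B
  refine ⟨T, le_antisymm (Submodule.span_mono ?_) (Submodule.span_le.2 ?_)⟩
  · rw [← hT]; exact Submodule.subset_span
  · rw [← hT]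
    exact Submodule.span_le_restrictScalars (𝓞 K) R _

end Localization

end HopfGaloisModule

/-! ### Local freeness of ambiguous ideals. -/

namespace HopfGaloisModule

variable {K L : Type*} [Field K] [NumberField K] [Field L] [NumberField L] [Algebra K L]
  (v : IsDedekindDomain.HeightOneSpectrum (𝓞 K))

/-- Any element of `L` has a nonzero multiple in a nonzero fractional ideal. -/
theorem exists_mul_mem_fractionalIdeal {B : FractionalIdeal (𝓞 L)⁰ L} (hB : B ≠ 0) (l : L) :
    ∃ s : 𝓞 K, s ≠ 0 ∧ algebraMap (𝓞 K) L s * l ∈ B := by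
  obtain ⟨b, hb, hb0⟩ : ∃ b ∈ B, b ≠ 0 := by
    by_contra! h
    exact hB (FractionalIdeal.eq_zero_iff.2 h)
  obtain ⟨s, hs, hint⟩ := ((IsFractionRing.isAlgebraic_iff (𝓞 K) K L).2
    (Algebra.IsAlgebraic.isAlgebraic (R := K) (l / b))).exists_integral_multiple
  have h1 : IsIntegral ℤ (s • (l / b) : L) := isIntegral_trans (A := 𝓞 K) _ hint
  refine ⟨s, hs, ?_⟩
  have h2 := (B : Submodule (𝓞 L) L).smul_mem (⟨s • (l / b), h1⟩ : 𝓞 L) hb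
  have h3 : algebraMap (𝓞 K) L s * l = (⟨s • (l / b), h1⟩ : 𝓞 L) • b := by
    rw [Algebra.smul_def]
    change _ = (s • (l / b)) * b
    rw [Algebra.smul_def, mul_assoc, div_mul_cancel₀ _ hb0]
  rw [h3]
  exact h2

namespace GPSubgroup

variable (P : GPSubgroup K L)

theorem algebraMap_smul_mem_order {z : P.GroupAlgebra} (hz : z ∈ P.fixedAlgebra) {s : 𝓞 K}
    (hs : ∀ η, IsIntegral ℤ (algebraMap (𝓞 K) L s * z.coeff η)) :
    algebraMap (𝓞 K) L s • z ∈ P.order := by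
  classical
  cases nonempty_fintype P.N
  have hc : ∀ η, ∃ c : 𝓞 L, algebraMap (𝓞 L) L c = algebraMap (𝓞 K) L s * z.coeff η := fun η =>
    ⟨⟨_, hs η⟩, rfl⟩
  choose c hc using hc
  refine P.mem_order _ |>.2 ⟨P.mem_integralGroupRing _ |>.2 ⟨∑ η, MonoidAlgebra.single η (c η),
    fun η => ?_⟩, ?_⟩
  · rw [MonoidAlgebra.coeff_sum, Finsupp.finsetSum_apply, Finset.sum_eq_single η]
    · rw [MonoidAlgebra.coeff_single, Finsupp.single_eq_same, MonoidAlgebra.coeff_smul, hc]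
      rfl
    · intro δ _ hδ
      rw [MonoidAlgebra.coeff_single, Finsupp.single_eq_of_ne hδ.symm]
    · simp
  · have : algebraMap (𝓞 K) L s • z = algebraMap (𝓞 K) K s • z := by
      rw [IsScalarTower.algebraMap_apply (𝓞 K) K L, algebraMap_smul]
    rw [this]
    exact P.fixedAlgebra.smul_mem hz _

/-- A common multiplier, outside a prime, that makes the coefficients of an element integral. -/
theorem exists_smul_mem_order {R : Type*} [CommRing R] [Algebra (𝓞 K) R]
    [IsLocalization.AtPrime R v.asIdeal] [Algebra R L] [IsScalarTower (𝓞 K) R L] [Fintype P.N]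
    {z : P.GroupAlgebra} (hz : z ∈ P.fixedAlgebra) (hzR : z ∈ integralCoeff R L P.N) :
    ∃ s ∉ v.asIdeal, algebraMap (𝓞 K) L s • z ∈ P.order := by
  classical
  have h1 : ∀ η, ∃ s : v.asIdeal.primeCompl, IsIntegral (𝓞 K) ((s : 𝓞 K) • z.coeff η) := fun η =>
    IsIntegral.exists_multiple_integral_of_isLocalization v.asIdeal.primeCompl _
      ((mem_integralCoeff z).1 hzR η)
  choose s hs using h1
  refine ⟨((∏ η, s η : v.asIdeal.primeCompl) : 𝓞 K), (∏ η, s η).2,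
    P.algebraMap_smul_mem_order hz fun η => ?_⟩
  obtain ⟨t, ht⟩ := Finset.dvd_prod_of_mem s (Finset.mem_univ η)
  have h2 : algebraMap (𝓞 K) L ((∏ η, s η : v.asIdeal.primeCompl) : 𝓞 K) * z.coeff η =
      algebraMap (𝓞 K) L t * ((s η : 𝓞 K) • z.coeff η) := by
    rw [ht, Algebra.smul_def, Submonoid.coe_mul, map_mul]
    ring
  rw [h2]
  exact isIntegral_trans (A := 𝓞 K) _ (isIntegral_algebraMap.mul (hs η))

/-- Locally at `v`, an ambiguous ideal is generated by one element. -/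
theorem exists_local_generator [IsGalois K L] (htame : IsTame K L)
    (hG : ∀ g h : Gal(L/K), g * h = h * g) (hN : ∀ η μ : P.N, η * μ = μ * η)
    (B : FractionalIdeal (𝓞 L)⁰ L) (hB : IsAmbiguous K B) :
    ∃ x ∈ B, ∃ s ∉ v.asIdeal, ∀ b ∈ B, ∃ z ∈ P.order, P.act z x = algebraMap (𝓞 K) L s * b := by
  classical
  cases nonempty_fintype P.N
  -- The localization is realized inside `K`, so that it acts on `L` compatibly.
  let R := Localization.subalgebra.ofField K v.asIdeal.primeCompl
    v.asIdeal.primeCompl_le_nonZeroDivisors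
  have hloc : IsLocalization.AtPrime R v.asIdeal :=
    Localization.subalgebra.isLocalization_ofField K v.asIdeal.primeCompl _
  have hdvr : IsDiscreteValuationRing R :=
    IsLocalization.AtPrime.isDiscreteValuationRing_of_dedekind_domain (𝓞 K) v.ne_bot R
  obtain ⟨p, hp, hpv⟩ := exists_prime_natCast_mem v
  have := Fact.mk hp
  have hpR : (p : R) ∈ IsLocalRing.maximalIdeal R := by
    rw [← map_natCast (algebraMap (𝓞 K) R), IsLocalization.AtPrime.to_map_mem_maximal_iff R v.asIdeal]
    exact hpv
  obtain ⟨x, hx, hgen⟩ := P.exists_generator_of_tame (R := R) hG hN p hpR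
    (fun Q hQ g hg => not_dvd_orderOf_of_isTame v R htame hp hpv Q hQ g hg)
    (Submodule.span R (B : Set L)) (span_localization_fg (K := K) R B)
    (fun a ha x hx => mul_mem_span_localization v R B ha hx) (by
      intro g x hx
      rw [mem_span_localization v] at hx ⊢
      obtain ⟨s, hs, hx⟩ := hx
      refine ⟨s, hs, ?_⟩
      have h1 : g (algebraMap (𝓞 K) L s * x) ∈ (B : Set L) := hB g ▸ ⟨_, hx, rfl⟩
      rwa [map_mul, IsScalarTower.algebraMap_apply (𝓞 K) K L, AlgEquiv.commutes,
        ← IsScalarTower.algebraMap_apply] at h1)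
  obtain ⟨s₀, hs₀, hx₀⟩ := (mem_span_localization v R B x).1 hx
  have hact : ∀ (c : L) (z : P.GroupAlgebra) (y : L), P.act (c • z) y = c * P.act z y := by
    intro c z y
    rw [map_smul]; rfl
  have hactK : ∀ (c : 𝓞 K) (z : P.GroupAlgebra) (y : L),
      P.act z (algebraMap (𝓞 K) L c * y) = algebraMap (𝓞 K) L c * P.act z y := by
    intro c z y
    rw [IsScalarTower.algebraMap_apply (𝓞 K) K L, ← Algebra.smul_def, ← Algebra.smul_def, map_smul]
  have hgen' : ∀ b ∈ B, ∃ s : v.asIdeal.primeCompl, ∃ z ∈ P.order,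
      P.act z (algebraMap (𝓞 K) L s₀ * x) = algebraMap (𝓞 K) L (s * s₀) * b := by
    intro b hb
    obtain ⟨z, hz, hzR, hzb⟩ := hgen b (Submodule.subset_span hb)
    obtain ⟨s, hs, hsz⟩ := P.exists_smul_mem_order v hz hzR
    refine ⟨⟨s, hs⟩, _, hsz, ?_⟩
    rw [hactK, hact, hzb, map_mul]
    ring
  obtain ⟨T, hT⟩ := exists_finset_span_eq K B
  have hTB : ∀ t : T, (t : L) ∈ B := fun t => by
    have : (t : L) ∈ (B : Set L) := hT ▸ Submodule.subset_span t.2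
    exact this
  choose s z hz hzact using fun t : T => hgen' t (hTB t)
  -- A common denominator for the finitely many generators of `B`; the factor `s₀` accounts for
  -- moving `x` into `B`.
  let s₁ : v.asIdeal.primeCompl := ∏ t, s t
  refine ⟨algebraMap (𝓞 K) L s₀ * x, hx₀, s₁ * s₀, (mul_mem s₁.2 hs₀ : _ ∈ v.asIdeal.primeCompl),
    fun b hb => ?_⟩
  have hb' : b ∈ Submodule.span (𝓞 K) (T : Set L) := by
    have : b ∈ (Submodule.span (𝓞 K) (T : Set L) : Set L) := hT ▸ hb
    exact this
  have hact' : ∀ (c : 𝓞 K) (w : P.GroupAlgebra), algebraMap (𝓞 K) L c • w = c • w := by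
    intro c w
    exact algebraMap_smul L c w
  induction hb' using Submodule.span_induction with
  | mem t ht =>
    obtain ⟨r, hr⟩ := Finset.dvd_prod_of_mem s (Finset.mem_univ (⟨t, ht⟩ : T))
    refine ⟨algebraMap (𝓞 K) L r • z ⟨t, ht⟩, ?_, ?_⟩
    · rw [hact']
      exact P.order.smul_mem (hz _) _
    · rw [hact, hzact]
      have : ((s₁ : 𝓞 K)) = s ⟨t, ht⟩ * r := congrArg Subtype.val hr
      rw [this]
      simp only [map_mul]
      ring
  | zero => exact ⟨0, zero_mem _, by simp⟩
  | add a b ha hbT iha ihb =>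
    have hmem : ∀ c ∈ Submodule.span (𝓞 K) (T : Set L), c ∈ B := fun c hc => by
      have : c ∈ (B : Set L) := hT ▸ hc
      exact this
    obtain ⟨z, hz, h1⟩ := iha (hmem a ha)
    obtain ⟨w, hw, h2⟩ := ihb (hmem b hbT)
    exact ⟨z + w, add_mem hz hw, by rw [map_add, LinearMap.add_apply, h1, h2, mul_add]⟩
  | smul c a ha iha =>
    have hmem : ∀ c ∈ Submodule.span (𝓞 K) (T : Set L), c ∈ B := fun c hc => by
      have : c ∈ (B : Set L) := hT ▸ hc
      exact this
    obtain ⟨z, hz, h1⟩ := iha (hmem a ha)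
    refine ⟨algebraMap (𝓞 K) L c • z, ?_, ?_⟩
    · rw [hact']
      exact P.order.smul_mem hz _
    · rw [hact, h1, Algebra.smul_def]
      ring

/-- The zero ideal is trivial. Otherwise let `z` kill the local generator `x`. Every `l` in `L` has
a nonzero `𝓞 K`-multiple of the form `w · x` with `w` in the order, and `z` kills it because `z` and
`w` commute. Thus `z` acts as zero, and faithfulness gives `z = 0`. -/
theorem isLocallyFree_idealModule [IsGalois K L] (htame : IsTame K L)
    (hG : ∀ g h : Gal(L/K), g * h = h * g)
    (hcomm : ∀ z ∈ P.fixedAlgebra, ∀ w ∈ P.fixedAlgebra, z * w = w * z)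
    (B : FractionalIdeal (𝓞 L)⁰ L) (hB : IsAmbiguous K B) :
    IsLocallyFree K P.order (P.idealModule B hB) := by
  intro v
  by_cases hB0 : B = 0
  · have hsub : Subsingleton (P.idealModule B hB) := ⟨fun a b => by
      have h1 : ∀ c : P.idealModule B hB, (c : L) = 0 := fun c => by
        have : (c : L) ∈ B := c.2
        exact FractionalIdeal.eq_zero_iff.1 hB0 _ this
      exact Subtype.ext ((h1 a).trans (h1 b).symm)⟩
    have hsub' : Subsingleton (v.adicCompletionIntegers K ⊗[𝓞 K] P.idealModule B hB) := inferInstance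
    let := baseChangeModule (𝓞 K) (v.adicCompletionIntegers K) P.order (P.idealModule B hB)
    exact Module.Free.of_subsingleton _ _
  · obtain ⟨x, hx, s, hs, hgen⟩ := P.exists_local_generator v htame hG
      (P.mul_comm_of_fixedAlgebra hcomm) B hB
    refine free_baseChange_of_generator s (isUnit_algebraMap_adicCompletionIntegers v hs)
      (⟨x, hx⟩ : P.idealModule B hB) (fun z hz => ?_) fun b => ?_
    · have hz0 : P.act z x = 0 := congrArg Subtype.val hz
      refine Subtype.ext (P.act_injective (LinearMap.ext fun l => ?_))
      obtain ⟨r, hr, hrl⟩ := exists_mul_mem_fractionalIdeal (K := K) hB0 l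
      obtain ⟨w, hw, hwl⟩ := hgen _ hrl
      have h1 : P.act z (P.act w x) = 0 := by
        rw [← Module.End.mul_apply, ← P.act_mul _ _ hw.2, hcomm _ z.2.2 _ hw.2,
          P.act_mul _ _ z.2.2, Module.End.mul_apply, hz0, map_zero]
      have hs0 : s ≠ 0 := fun h => hs (h ▸ zero_mem _)
      rw [hwl, ← mul_assoc, ← map_mul, IsScalarTower.algebraMap_apply (𝓞 K) K L, ← Algebra.smul_def,
        map_smul, smul_eq_zero] at h1
      refine (h1.resolve_left ?_).trans (by simp)
      exact fun h => mul_ne_zero hs0 hr (IsFractionRing.to_map_eq_zero_iff.1 h)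
    · obtain ⟨z, hz, hzb⟩ := hgen b b.2
      refine ⟨⟨z, hz⟩, Subtype.ext ?_⟩
      change P.act z x = s • (b : L)
      rw [hzb, Algebra.smul_def]

end GPSubgroup

end HopfGaloisModule

/-! ### Base change of `H` to `L` and Galois descent. -/

namespace HopfGaloisModule

section BaseChange

variable (K L H : Type*) [Field K] [Field L] [Algebra K L] [CommRing H] [HopfAlgebra K H]

/-- The `K`-linear map `H ⊗ H → (L ⊗ H) ⊗ (L ⊗ H)` sending `a ⊗ b` to `(1 ⊗ a) ⊗ (1 ⊗ b)`. -/
noncomputable def tensorIncl : H ⊗[K] H →ₗ[K] (L ⊗[K] H) ⊗[L] (L ⊗[K] H) :=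
  TensorProduct.mapOfCompatibleSMul L K K (L ⊗[K] H) (L ⊗[K] H) ∘ₗ
    TensorProduct.map (TensorProduct.mk K L H 1) (TensorProduct.mk K L H 1)

theorem tensorIncl_tmul (a b : H) :
    tensorIncl K L H (a ⊗ₜ b) = ((1 : L) ⊗ₜ[K] a) ⊗ₜ[L] ((1 : L) ⊗ₜ[K] b) := rfl

theorem comul_tmul_eq (c : L) (h : H) :
    Coalgebra.comul (R := L) (c ⊗ₜ[K] h) =
      c • tensorIncl K L H (Coalgebra.comul (R := K) h) := by
  rw [TensorProduct.comul_tmul]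
  generalize Coalgebra.comul (R := K) h = x
  induction x with
  | zero => simp
  | add a b ha hb => rw [TensorProduct.tmul_add, map_add, map_add, smul_add, ha, hb]
  | tmul a b =>
    rw [CommSemiring.comul_apply, TensorProduct.AlgebraTensorModule.tensorTensorTensorComm_tmul,
      tensorIncl_tmul, ← TensorProduct.tmul_smul, TensorProduct.smul_tmul', smul_eq_mul, mul_one]

variable {K L} in
/-- The action of an automorphism of `L` on `L ⊗ H`. -/
noncomputable def galTensor (g : Gal(L/K)) : L ⊗[K] H →ₐ[K] L ⊗[K] H :=
  Algebra.TensorProduct.map (g : L →ₐ[K] L) (AlgHom.id K H)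

variable {K L} in
theorem galTensor_tmul (g : Gal(L/K)) (c : L) (h : H) :
    galTensor H g (c ⊗ₜ h) = g c ⊗ₜ h := by
  simp [galTensor]

variable {K L} in
theorem galTensor_smul (g : Gal(L/K)) (c : L) (z : L ⊗[K] H) :
    galTensor H g (c • z) = g c • galTensor H g z := by
  induction z with
  | zero => simp
  | add a b ha hb => rw [smul_add, map_add, map_add, smul_add, ha, hb]
  | tmul d h => rw [TensorProduct.smul_tmul', galTensor_tmul, galTensor_tmul,
      TensorProduct.smul_tmul', smul_eq_mul, smul_eq_mul, map_mul]

variable {K L} in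
/-- The elements of `L ⊗ H` fixed by the Galois group come from `H`. -/
theorem exists_eq_one_tmul [FiniteDimensional K L] [IsGalois K L] (z : L ⊗[K] H)
    (hz : ∀ g : Gal(L/K), galTensor H g z = z) : ∃ h : H, z = 1 ⊗ₜ h := by
  let b := Module.Free.chooseBasis K H
  let B := Algebra.TensorProduct.basis L b
  have h1 : ∀ (g : Gal(L/K)) (w : L ⊗[K] H) i, B.repr (galTensor H g w) i = g (B.repr w i) := by
    intro g w i
    induction w with
    | zero => simp
    | add a b ha hb => rw [map_add, map_add, map_add, Finsupp.add_apply, ha, hb, Finsupp.add_apply,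
        map_add]
    | tmul c h =>
      rw [galTensor_tmul, Algebra.TensorProduct.basis_repr_tmul,
        Algebra.TensorProduct.basis_repr_tmul]
      simp
  have h2 : ∀ i, ∃ k : K, algebraMap K L k = B.repr z i := fun i =>
    (IsGalois.mem_range_algebraMap_iff_fixed (F := K) _).2 fun g => by rw [← h1, hz]
  choose k hk using h2
  refine ⟨∑ i ∈ (B.repr z).support, k i • b i, ?_⟩
  conv_lhs => rw [← B.linearCombination_repr z, Finsupp.linearCombination_apply, Finsupp.sum]
  rw [TensorProduct.tmul_sum]
  refine Finset.sum_congr rfl fun i _ => ?_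
  rw [TensorProduct.tmul_smul, ← hk, algebraMap_smul, Algebra.TensorProduct.basis_apply]

end BaseChange

/-! ### Group-like elements attached to automorphisms. -/

section GroupLike

variable {K L H : Type*} [Field K] [Field L] [Algebra K L] [CommRing H] [HopfAlgebra K H]
  [Module H L] [IsScalarTower K H L]

theorem galoisMap_smul (c : L) (z : L ⊗[K] H) (x : L) :
    galoisMap K L H (c • z) x = c * galoisMap K L H z x := by
  induction z with
  | zero => simp
  | add a b ha hb => rw [smul_add, map_add, map_add, LinearMap.add_apply, LinearMap.add_apply,
      mul_add, ha, hb]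
  | tmul d h => rw [TensorProduct.smul_tmul', galoisMap_tmul, galoisMap_tmul, smul_eq_mul, mul_assoc]

variable (K L H) in
/-- The map `galoisMap` is `L`-linear. -/
noncomputable def galoisMapL : L ⊗[K] H →ₗ[L] (L →ₗ[K] L) :=
  { toFun := galoisMap K L H
    map_add' := map_add _
    map_smul' := fun c z => LinearMap.ext fun x => galoisMap_smul c z x }

variable (K L H) in
/-- For `s t : L`, the `L`-linear map sending `a ⊗ b` to `j(a)(s) * j(b)(t)`. -/
noncomputable def galoisMap₂ (s t : L) : (L ⊗[K] H) ⊗[L] (L ⊗[K] H) →ₗ[L] L :=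
  LinearMap.mul' L L ∘ₗ TensorProduct.map
    (LinearMap.applyₗ' L s ∘ₗ galoisMapL K L H) (LinearMap.applyₗ' L t ∘ₗ galoisMapL K L H)

theorem galoisMap₂_tmul (s t : L) (a b : L ⊗[K] H) :
    galoisMap₂ K L H s t (a ⊗ₜ b) = galoisMap K L H a s * galoisMap K L H b t := rfl

variable (hH : IsHopfGalois K L H)

include hH

theorem galoisMap₂_comul (s t : L) (z : L ⊗[K] H) :
    galoisMap₂ K L H s t (Coalgebra.comul (R := L) z) = galoisMap K L H z (s * t) := by
  induction z with
  | zero => simp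
  | add a b ha hb => rw [map_add, map_add, map_add, LinearMap.add_apply, ha, hb]
  | tmul c h =>
    rw [comul_tmul_eq, map_smul, galoisMap_tmul, hH.smul_mul, smul_eq_mul]
    congr 1
    generalize Coalgebra.comul (R := K) h = x
    induction x with
    | zero => simp
    | add a b ha hb => rw [map_add, map_add, map_add, ha, hb]
    | tmul a b =>
      rw [tensorIncl_tmul, galoisMap₂_tmul, galoisMap_tmul, galoisMap_tmul, actMul_tmul, one_mul,
        one_mul]

theorem counit_eq_galoisMap_one (z : L ⊗[K] H) :
    Coalgebra.counit (R := L) z = galoisMap K L H z 1 := by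
  induction z with
  | zero => simp
  | add a b ha hb => rw [map_add, map_add, LinearMap.add_apply, ha, hb]
  | tmul c h =>
    rw [galoisMap_tmul, hH.smul_one]
    simp [Algebra.smul_def, mul_comm]

/-- The element of `L ⊗ H` that acts on `L` as the automorphism `g`. -/
noncomputable def galElem (g : Gal(L/K)) : L ⊗[K] H :=
  (hH.bijective.2 (g : L →ₐ[K] L).toLinearMap).choose

theorem galoisMap_galElem (g : Gal(L/K)) (x : L) : galoisMap K L H (galElem hH g) x = g x := by
  rw [galElem, (hH.bijective.2 (g : L →ₐ[K] L).toLinearMap).choose_spec]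
  rfl

theorem eq_of_galoisMap_eq {z w : L ⊗[K] H} (h : ∀ x, galoisMap K L H z x = galoisMap K L H w x) :
    z = w := hH.bijective.1 (LinearMap.ext h)

theorem linearIndependent_galElem : LinearIndependent L (galElem hH) := by
  have h1 : Function.Injective fun g : Gal(L/K) => (g : L →ₐ[K] L) := fun g h hgh =>
    AlgEquiv.ext fun x => DFunLike.congr_fun hgh x
  have h2 := (linearIndependent_toLinearMap K L L).comp _ h1
  refine LinearIndependent.of_comp (galoisMapL K L H) ?_
  have h3 : galoisMapL K L H ∘ galElem hH = AlgHom.toLinearMap ∘ fun g : Gal(L/K) =>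
      (g : L →ₐ[K] L) := funext fun g => LinearMap.ext fun x => galoisMap_galElem hH g x
  rw [h3]
  exact h2

variable [FiniteDimensional K L] [IsGalois K L]

theorem span_galElem : Submodule.span L (Set.range (galElem hH)) = ⊤ := by
  classical
  have hlin := linearIndependent_galElem hH
  let e : (L ⊗[K] H) ≃ₗ[L] (L →ₗ[K] L) := LinearEquiv.ofBijective (galoisMapL K L H) hH.bijective
  have hfin : Module.Finite L (L →ₗ[K] L) := inferInstance
  have : Module.Finite L (L ⊗[K] H) := Module.Finite.equiv e.symm
  refine LinearIndependent.span_eq_top_of_card_eq_finrank hlin ?_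
  rw [e.finrank_eq, Module.finrank_linearMap_self, ← Nat.card_eq_fintype_card,
    IsGalois.card_aut_eq_finrank]

/-- Multiplicativity of `g` says that the comultiplication and the tensor square of its element
agree under all the functionals `galoisMap₂ K L H s t`. These functionals separate points, by
independence of automorphisms applied in `t` and then in `s`. -/
theorem isGroupLikeElem_galElem (g : Gal(L/K)) : IsGroupLikeElem L (galElem hH g) := by
  classical
  refine ⟨?_, ?_⟩
  · rw [counit_eq_galoisMap_one hH, galoisMap_galElem, map_one]
  · let b : Module.Basis Gal(L/K) L (L ⊗[K] H) :=
      Module.Basis.mk (linearIndependent_galElem hH) (span_galElem hH).ge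
    have hb : ∀ g, b g = galElem hH g := fun g => by rw [Module.Basis.mk_apply]
    have hli : LinearIndependent L fun (g : Gal(L/K)) (x : L) => g x :=
      (linearIndependent_monoidHom L L).comp (fun g : Gal(L/K) => ((g : L →ₐ[K] L) : L →* L))
        fun g h hgh => AlgEquiv.ext fun x => DFunLike.congr_fun hgh x
    rw [Fintype.linearIndependent_iff] at hli
    rw [← sub_eq_zero]
    set w := Coalgebra.comul (R := L) (galElem hH g) - galElem hH g ⊗ₜ[L] galElem hH g with hw
    have h0 : ∀ s t, galoisMap₂ K L H s t w = 0 := by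
      intro s t
      rw [hw, map_sub, galoisMap₂_comul hH, galoisMap₂_tmul]
      simp only [galoisMap_galElem]
      rw [map_mul, sub_self]
    let BB := b.tensorProduct b
    have hsum : ∀ s t, ∑ q : Gal(L/K) × Gal(L/K), BB.repr w q * (q.1 s * q.2 t) = 0 := by
      intro s t
      rw [← h0 s t]
      conv_rhs => rw [← BB.sum_repr w]
      rw [map_sum]
      refine Finset.sum_congr rfl fun q _ => ?_
      rw [map_smul, Module.Basis.tensorProduct_apply, galoisMap₂_tmul, hb, hb, galoisMap_galElem,
        galoisMap_galElem, smul_eq_mul]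
    have hzero : ∀ g h, BB.repr w (g, h) = 0 := by
      intro g h
      refine hli (fun g => BB.repr w (g, h)) ?_ g
      ext s
      have := hli (fun h => ∑ g : Gal(L/K), BB.repr w (g, h) * g s) (by
        ext t
        rw [Pi.zero_apply, ← hsum s t, Fintype.sum_prod_type_right, Finset.sum_apply]
        refine Finset.sum_congr rfl fun h _ => ?_
        rw [Pi.smul_apply, smul_eq_mul, Finset.sum_mul]
        exact Finset.sum_congr rfl fun g _ => mul_assoc _ _ _) h
      rw [Finset.sum_apply]
      exact this
    refine BB.repr.map_eq_zero_iff.1 ?_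
    ext q
    exact hzero q.1 q.2

-- The map `j` is not multiplicative for the componentwise product on `L ⊗ H`. When the left factor
-- acts as `g`, twisting the right factor by `g` makes the product act as the composite.
omit [FiniteDimensional K L] [IsGalois K L] in
theorem galElem_mul_galTensor (g g' : Gal(L/K)) :
    galElem hH g * galTensor H g (galElem hH g') = galElem hH (g * g') := by
  refine eq_of_galoisMap_eq hH fun x => ?_
  have key : ∀ w z : L ⊗[K] H, (∀ x, galoisMap K L H z x = g x) →
      galoisMap K L H (z * galTensor H g w) x = g (galoisMap K L H w x) := by
    intro w z hz
    induction w with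
    | zero => simp
    | add a b ha hb => rw [map_add, mul_add, map_add, map_add, LinearMap.add_apply, ha, hb,
        LinearMap.add_apply, map_add]
    | tmul c h =>
      rw [galTensor_tmul, galoisMap_tmul, map_mul g, ← hz (h • x)]
      clear hz
      induction z with
      | zero => simp
      | add a b ha hb => rw [add_mul, map_add, map_add, LinearMap.add_apply, ha, hb,
          LinearMap.add_apply, mul_add]
      | tmul d a =>
        rw [Algebra.TensorProduct.tmul_mul_tmul, galoisMap_tmul, galoisMap_tmul, mul_smul]
        ring
  rw [key _ _ (galoisMap_galElem hH g), galoisMap_galElem, galoisMap_galElem, AlgEquiv.mul_apply]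

end GroupLike

end HopfGaloisModule

/-! ### The underlying group built from group-like elements. -/

namespace HopfGaloisModule

section UnderlyingGroup

variable {K L H : Type*} [Field K] [Field L] [Algebra K L] [CommRing H] [HopfAlgebra K H]
  [Module H L] [IsScalarTower K H L] [FiniteDimensional K L] [IsGalois K L]
  (hH : IsHopfGalois K L H)

include hH

/-- Group-like elements are linearly independent, while those coming from automorphisms already
span. -/
theorem bijective_galElem : Function.Bijective fun g : Gal(L/K) =>
    (⟨galElem hH g, isGroupLikeElem_galElem hH g⟩ : GroupLike L (L ⊗[K] H)) := by
  refine ⟨fun g g' h => (linearIndependent_galElem hH).injective (congrArg GroupLike.val h),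
    fun η => ?_⟩
  by_contra hη
  have h1 := (linearIndep_groupLikeVal (R := L) (A := L ⊗[K] H)).notMem_span_image
    (s := Set.range fun g : Gal(L/K) => (⟨galElem hH g, isGroupLikeElem_galElem hH g⟩ :
      GroupLike L (L ⊗[K] H))) (x := η) hη
  rw [← Set.range_comp] at h1
  have h2 := span_galElem hH
  have h3 : (GroupLike.val ∘ fun g : Gal(L/K) => (⟨galElem hH g, isGroupLikeElem_galElem hH g⟩ :
      GroupLike L (L ⊗[K] H))) = galElem hH := rfl
  rw [h3, h2] at h1
  exact h1 trivial

/-- The bijection of `Gal(L/K)` onto the group-like elements of `L ⊗ H`. -/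
noncomputable def galGroupLike : Gal(L/K) ≃ GroupLike L (L ⊗[K] H) :=
  Equiv.ofBijective _ (bijective_galElem hH)

theorem galGroupLike_val (g : Gal(L/K)) : (galGroupLike hH g).val = galElem hH g := rfl

theorem galGroupLike_one : galGroupLike hH 1 = 1 := by
  refine GroupLike.val_injective (eq_of_galoisMap_eq hH fun x => ?_)
  rw [galGroupLike_val, galoisMap_galElem, GroupLike.val_one, Algebra.TensorProduct.one_def,
    galoisMap_tmul]
  simp

/-- The action of an automorphism of `L` on the group-like elements of `L ⊗ H`. -/
noncomputable def conjGroupLike (g : Gal(L/K)) (η : GroupLike L (L ⊗[K] H)) :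
    GroupLike L (L ⊗[K] H) :=
  (galGroupLike hH g)⁻¹ * galGroupLike hH (g * (galGroupLike hH).symm η)

/-- This rearranges `x_g * g(x_k) = x_{gk}`. It identifies `conjGroupLike`, whose values are
group-like by construction, with the Galois action on coefficients. -/
theorem conjGroupLike_val (g : Gal(L/K)) (η : GroupLike L (L ⊗[K] H)) :
    (conjGroupLike hH g η).val = galTensor H g η.val := by
  obtain ⟨g', rfl⟩ := (galGroupLike hH).surjective η
  rw [conjGroupLike, Equiv.symm_apply_apply, GroupLike.val_mul, galGroupLike_val hH (g * g'),
    ← galElem_mul_galTensor hH, ← mul_assoc, ← galGroupLike_val hH g, ← GroupLike.val_mul,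
    inv_mul_cancel, GroupLike.val_one, one_mul, galGroupLike_val]

theorem conjGroupLike_mul (g : Gal(L/K)) (η μ : GroupLike L (L ⊗[K] H)) :
    conjGroupLike hH g (η * μ) = conjGroupLike hH g η * conjGroupLike hH g μ :=
  GroupLike.val_injective <| by
    rw [GroupLike.val_mul, conjGroupLike_val, conjGroupLike_val, conjGroupLike_val,
      GroupLike.val_mul, map_mul]

/-- The bijection of `Gal(L/K)` onto the group-like elements of `L ⊗ H` through which the latter
act on the former by left translation. -/
noncomputable def galEquiv : Gal(L/K) ≃ GroupLike L (L ⊗[K] H) :=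
  (galGroupLike hH).trans (Equiv.inv _)

theorem galEquiv_apply (g : Gal(L/K)) : galEquiv hH g = (galGroupLike hH g)⁻¹ := rfl

/-- The inverted form of `x_g * g(x_k) = x_{gk}`. It is what makes conjugation by left translations
correspond to the Galois action on group-likes. -/
theorem galEquiv_mul (g k : Gal(L/K)) :
    galEquiv hH (g * k) = conjGroupLike hH g (galEquiv hH k) * galEquiv hH g := by
  have h1 : conjGroupLike hH g (galGroupLike hH k) =
      (galGroupLike hH g)⁻¹ * galGroupLike hH (g * k) := by
    rw [conjGroupLike, Equiv.symm_apply_apply]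
  have h2 : conjGroupLike hH g 1 = 1 := by
    rw [← mul_left_cancel_iff (a := conjGroupLike hH g 1), ← conjGroupLike_mul, mul_one, mul_one]
  have h3 : conjGroupLike hH g (galGroupLike hH k)⁻¹ =
      (conjGroupLike hH g (galGroupLike hH k))⁻¹ := by
    rw [eq_inv_iff_mul_eq_one, ← conjGroupLike_mul, inv_mul_cancel, h2]
  rw [galEquiv_apply, galEquiv_apply, galEquiv_apply, h3, h1, mul_inv_rev, inv_inv,
    mul_inv_cancel_right]

/-- The action of the group-like elements of `L ⊗ H` on `Gal(L/K)` as a regular permutation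
group. -/
noncomputable def permGroupLike : GroupLike L (L ⊗[K] H) →* Equiv.Perm Gal(L/K) where
  toFun η := (galEquiv hH).trans ((Equiv.mulLeft η).trans (galEquiv hH).symm)
  map_one' := by ext1 g; simp
  map_mul' η μ := by ext1 g; simp

theorem permGroupLike_apply (η : GroupLike L (L ⊗[K] H)) (g : Gal(L/K)) :
    permGroupLike hH η g = (galEquiv hH).symm (η * galEquiv hH g) := rfl

theorem galEquiv_permGroupLike (η : GroupLike L (L ⊗[K] H)) (g : Gal(L/K)) :
    galEquiv hH (permGroupLike hH η g) = η * galEquiv hH g := by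
  rw [permGroupLike_apply, Equiv.apply_symm_apply]

theorem permGroupLike_injective : Function.Injective (permGroupLike hH) := fun η μ h => by
  have h1 := congrArg (galEquiv hH) (DFunLike.congr_fun h 1)
  rw [galEquiv_permGroupLike, galEquiv_permGroupLike] at h1
  exact mul_right_cancel h1

theorem conj_permGroupLike (g : Gal(L/K)) (η : GroupLike L (L ⊗[K] H)) :
    Equiv.mulLeft g * permGroupLike hH η * (Equiv.mulLeft g)⁻¹ =
      permGroupLike hH (conjGroupLike hH g η) := by
  rw [mul_inv_eq_iff_eq_mul]
  ext1 k
  refine (galEquiv hH).injective ?_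
  rw [Equiv.Perm.mul_apply, Equiv.Perm.mul_apply, galEquiv_permGroupLike, Equiv.coe_mulLeft,
    galEquiv_mul, galEquiv_permGroupLike, conjGroupLike_mul, galEquiv_mul, mul_assoc]

/-- The inverse built into `galEquiv` makes `η⁻¹ 1` the very automorphism through which `η` acts on
`L`, as the formula for `act` requires. -/
theorem permGroupLike_inv_one (η : GroupLike L (L ⊗[K] H)) :
    (permGroupLike hH η)⁻¹ 1 = (galGroupLike hH).symm η := by
  refine (galEquiv hH).injective ?_
  rw [← map_inv, galEquiv_permGroupLike, galEquiv_apply, galEquiv_apply, galGroupLike_one,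
    Equiv.apply_symm_apply, inv_one, mul_one]

/-- The group-like elements of `L ⊗ H`, as a regular group of permutations of `Gal(L/K)`. -/
noncomputable def groupLikeSubgroup : GPSubgroup K L where
  N := (permGroupLike hH).range
  regular g h := by
    refine ⟨⟨permGroupLike hH (galEquiv hH h * (galEquiv hH g)⁻¹), _, rfl⟩, ?_, ?_⟩
    · refine (galEquiv hH).injective ?_
      rw [galEquiv_permGroupLike, inv_mul_cancel_right]
    · rintro ⟨_, η, rfl⟩ rfl
      simp only [galEquiv_permGroupLike, mul_inv_cancel_right]
  normalized := by
    rintro g _ ⟨η, rfl⟩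
    exact ⟨conjGroupLike hH g η, (conj_permGroupLike hH g η).symm⟩

/-- The group-like elements of `L ⊗ H` as a permutation group of `Gal(L/K)`. -/
noncomputable def groupLikeEquiv : GroupLike L (L ⊗[K] H) ≃* (groupLikeSubgroup hH).N :=
  MonoidHom.ofInjective (permGroupLike_injective hH)

theorem groupLikeEquiv_val (η : GroupLike L (L ⊗[K] H)) :
    (groupLikeEquiv hH η : Equiv.Perm Gal(L/K)) = permGroupLike hH η := rfl

theorem conj_groupLikeEquiv (g : Gal(L/K)) (η : GroupLike L (L ⊗[K] H)) :
    (groupLikeSubgroup hH).conj g (groupLikeEquiv hH η) =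
      groupLikeEquiv hH (conjGroupLike hH g η) :=
  Subtype.ext (conj_permGroupLike hH g η)

/-- The homomorphism from the group algebra of the group-like elements to `L ⊗ H`. -/
noncomputable def groupAlgebraHom : (groupLikeSubgroup hH).GroupAlgebra →ₐc[L] L ⊗[K] H :=
  (MonoidAlgebra.liftGroupLikeBialgHom (R := L) (A := L ⊗[K] H)).comp
    (MonoidAlgebra.mapDomainBialgHom L ((groupLikeEquiv hH).symm : _ →* GroupLike L (L ⊗[K] H)))

theorem groupAlgebraHom_single (η : GroupLike L (L ⊗[K] H)) (c : L) :
    groupAlgebraHom hH (MonoidAlgebra.single (groupLikeEquiv hH η) c) = c • η.val := by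
  simp [groupAlgebraHom]

theorem groupAlgebraHom_bijective : Function.Bijective (groupAlgebraHom hH) := by
  have hli : LinearIndependent L fun η : (groupLikeSubgroup hH).N =>
      ((groupLikeEquiv hH).symm η).val :=
    (linearIndep_groupLikeVal (R := L) (A := L ⊗[K] H)).comp _ (groupLikeEquiv hH).symm.injective
  have heq : ∀ z, groupAlgebraHom hH z = Finsupp.linearCombination L
      (fun η : (groupLikeSubgroup hH).N => ((groupLikeEquiv hH).symm η).val)
      (MonoidAlgebra.coeffLinearEquiv L z) := by
    intro z
    induction z using MonoidAlgebra.induction_linear with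
    | zero => simp
    | add a b ha hb => rw [map_add, map_add, map_add, ha, hb]
    | single η c =>
      obtain ⟨η, rfl⟩ := (groupLikeEquiv hH).surjective η
      rw [groupAlgebraHom_single]
      simp
  constructor
  · intro z w h
    rw [heq, heq] at h
    exact (MonoidAlgebra.coeffLinearEquiv L).injective (hli h)
  · intro z
    have h1 : z ∈ Submodule.span L (Set.range (galElem hH)) := by rw [span_galElem]; trivial
    induction h1 using Submodule.span_induction with
    | mem x hx =>
      obtain ⟨g, rfl⟩ := hx
      exact ⟨_, (groupAlgebraHom_single hH (galGroupLike hH g) 1).trans (one_smul _ _)⟩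
    | zero => exact ⟨0, map_zero _⟩
    | add x y _ _ hx hy =>
      obtain ⟨a, rfl⟩ := hx
      obtain ⟨b, rfl⟩ := hy
      exact ⟨a + b, map_add _ _ _⟩
    | smul c x _ hx =>
      obtain ⟨a, rfl⟩ := hx
      exact ⟨c • a, map_smul _ _ _⟩

theorem groupAlgebraHom_galAct (g : Gal(L/K)) (z : (groupLikeSubgroup hH).GroupAlgebra) :
    groupAlgebraHom hH ((groupLikeSubgroup hH).galAct g z) =
      galTensor H g (groupAlgebraHom hH z) := by
  induction z using MonoidAlgebra.induction_linear with
  | zero => simp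
  | add a b ha hb => rw [map_add, map_add, map_add, map_add, ha, hb]
  | single η c =>
    obtain ⟨η, rfl⟩ := (groupLikeEquiv hH).surjective η
    rw [GPSubgroup.galAct_single, conj_groupLikeEquiv, groupAlgebraHom_single,
      groupAlgebraHom_single, galTensor_smul, conjGroupLike_val]

theorem act_eq_galoisMap (z : (groupLikeSubgroup hH).GroupAlgebra) (x : L) :
    (groupLikeSubgroup hH).act z x = galoisMap K L H (groupAlgebraHom hH z) x := by
  induction z using MonoidAlgebra.induction_linear with
  | zero => simp
  | add a b ha hb => rw [map_add, map_add, map_add, LinearMap.add_apply, LinearMap.add_apply, ha, hb]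
  | single η c =>
    obtain ⟨η, rfl⟩ := (groupLikeEquiv hH).surjective η
    rw [GPSubgroup.act_single, groupAlgebraHom_single, galoisMap_smul, groupLikeEquiv_val,
      permGroupLike_inv_one]
    obtain ⟨g, rfl⟩ := (galGroupLike hH).surjective η
    rw [Equiv.symm_apply_apply, galGroupLike_val, galoisMap_galElem]

theorem isUnderlyingGroup_groupLikeSubgroup : IsUnderlyingGroup H (groupLikeSubgroup hH) := by
  let e : (groupLikeSubgroup hH).GroupAlgebra ≃ₐ[L] L ⊗[K] H :=
    AlgEquiv.ofBijective (groupAlgebraHom hH : _ →ₐ[L] L ⊗[K] H) (groupAlgebraHom_bijective hH)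
  let φ : H →ₐ[K] (groupLikeSubgroup hH).GroupAlgebra :=
    (e.symm.toAlgHom.restrictScalars K).comp Algebra.TensorProduct.includeRight
  have hφ : ∀ h, groupAlgebraHom hH (φ h) = 1 ⊗ₜ h := fun h => e.apply_symm_apply (1 ⊗ₜ h)
  have hφ' : ∀ z h, groupAlgebraHom hH z = 1 ⊗ₜ h → φ h = z := fun z h hz =>
    (groupAlgebraHom_bijective hH).1 (by rw [hφ, hz])
  refine ⟨φ, ?_, ?_, ?_, ?_, ?_⟩
  · intro a b hab
    have h1 : (1 : L) ⊗ₜ[K] a = 1 ⊗ₜ b := by rw [← hφ, ← hφ, hab]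
    exact Algebra.TensorProduct.includeRight_injective (algebraMap K L).injective h1
  · ext z
    rw [GPSubgroup.mem_fixedAlgebra]
    constructor
    · rintro ⟨h, rfl⟩ g
      refine (groupAlgebraHom_bijective hH).1 ?_
      change groupAlgebraHom hH ((groupLikeSubgroup hH).galAct g (φ h)) =
        groupAlgebraHom hH (φ h)
      rw [groupAlgebraHom_galAct, hφ, galTensor_tmul, map_one]
    -- Galois descent: the image of a fixed element in `L ⊗ H` is Galois-invariant, so it comes from
    -- `H`.
    · intro hz
      obtain ⟨h, hh⟩ := exists_eq_one_tmul H (groupAlgebraHom hH z) fun g => by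
        rw [← groupAlgebraHom_galAct, hz]
      exact ⟨h, hφ' z h hh⟩
  · intro h
    rw [← CoalgHomClass.counit_comp_apply (groupAlgebraHom hH), hφ]
    simp [Algebra.smul_def]
  · intro h
    have hinj : Function.Injective (TensorProduct.map
        (e.toLinearMap) (e.toLinearMap)) :=
      (TensorProduct.congr e.toLinearEquiv e.toLinearEquiv).injective
    refine hinj ?_
    have h1 := CoalgHomClass.map_comp_comul_apply (groupAlgebraHom hH) (φ h)
    rw [hφ, comul_tmul_eq, one_smul] at h1
    refine h1.trans ?_
    generalize Coalgebra.comul (R := K) h = x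
    induction x with
    | zero => simp
    | add a b ha hb => simp only [map_add, ha, hb]
    | tmul a b =>
      rw [tensorIncl_tmul, ← hφ a, ← hφ b]
      rfl
  · intro h x
    rw [act_eq_galoisMap, hφ, galoisMap_tmul, one_mul]

end UnderlyingGroup

end HopfGaloisModule

theorem theorem6p2 (K L : Type*) [Field K] [NumberField K] [Field L] [NumberField L] [Algebra K L]
    [IsAbelianGalois K L] (htame : HopfGaloisModule.IsTame K L)
    (H : Type*) [CommRing H] [HopfAlgebra K H] [Module H L] [IsScalarTower K H L]
    (hH : HopfGaloisModule.IsHopfGalois K L H)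
    (B : FractionalIdeal (𝓞 L)⁰ L) (hB : HopfGaloisModule.IsAmbiguous K B) :
    (∃ P : HopfGaloisModule.GPSubgroup K L, HopfGaloisModule.IsUnderlyingGroup H P) ∧
      ∀ P : HopfGaloisModule.GPSubgroup K L, HopfGaloisModule.IsUnderlyingGroup H P →
        HopfGaloisModule.IsLocallyFree K P.order (P.idealModule B hB) := by
  refine ⟨⟨_, HopfGaloisModule.isUnderlyingGroup_groupLikeSubgroup hH⟩, ?_⟩
  rintro P ⟨φ, -, hφ, -⟩
  -- Only the identification of the fixed ring with the image of the commutative ring `H` is needed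
  -- from here on.
  refine P.isLocallyFree_idealModule htame (fun g h => mul_comm' g h) (fun z hz w hw => ?_) B hB
  rw [← hφ] at hz hw
  obtain ⟨a, rfl⟩ := hz
  obtain ⟨b, rfl⟩ := hw
  exact (map_mul φ a b).symm.trans ((congrArg φ (mul_comm a b)).trans (map_mul φ b a))
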